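/- Let $\mathbb F$ be a field, $G$ an arbitrary group (written multiplicatively), $n>2$, and let $UT_n^{(-)}$ be the Lie algebra of upper triangular $n\times n$ matrices over $\mathbb F$ with bracket $[a,b]=ab-ba$; let $e_{ij}$ be the matrix units and $I$ the identity matrix. A $G$-grading on a Lie algebra $L$ is a vector space decomposition $L=\bigoplus_{h\in G}L_h$ with $[L_h,L_k]\subseteq L_{hk}$. Two $G$-graded Lie algebras are *graded isomorphic* if there is a Lie isomorphism mapping each homogeneous component into the component of the same degree; they are *practically graded isomorphic* if there is an isomorphism $\psi:L_1\to L_2$ of ungraded Lie algebras which induces a graded isomorphism $L_1/\mathfrak z(L_1)\to L_2/\mathfrak z(L_2)$ of the quotients by the centres, with the induced gradings. *Elementary case.* For $t\in G$ and a sequence $\eta=(g_1,\dots,g_{n-1})$ of pairwise commuting elements of $G$, a practical elementary grading $\Gamma_1(t,\eta)$ is a $G$-grading on $UT_n^{(-)}$ for which each $e_{i,i+1}$ is in the component of degree $g_i$, $I$ is in the component of degree $t$, and some subspace $V$ with $\{\text{diagonal matrices}\}=\mathbb F I\oplus V$ is contained in the component of degree $1$. Such gradings exist. Let $\mathrm{rev}\,\eta=(g_{n-1},\dots,g_1)$,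 and write $\eta\sim\eta'$ if $\eta=\eta'$ or $\eta=\mathrm{rev}\,\eta'$. For all $t,t'\in G$ and all sequences $\eta,\eta'\in G^{n-1}$, each consisting of pairwise commuting elements, and whichever gradings $\Gamma_1(t,\eta)$, $\Gamma_1(t',\eta')$ with these parameters are taken: 1. $\Gamma_1(t,\eta)$ and $\Gamma_1(t',\eta')$ are graded isomorphic if and only if $t=t'$ and $\eta\sim\eta'$; 2. $\Gamma_1(t,\eta)$ and $\Gamma_1(t',\eta')$ are practically graded isomorphic if and only if $\eta\sim\eta'$. *Type 2 case.* Assume $\mathrm{char}\,\mathbb F\neq 2$ and put $X_{ij}^{\pm}=e_{ij}\pm e_{n-j+1,n-i+1}$ for $i\le j$. Let $g\in G$ with $g\ne 1=g^2$ and let $\eta=\mathrm{rev}\,\eta\in G^{n-1}$, where $g,g_1,\dots,g_{n-1}$ commute pairwise. A type 2 grading $\Gamma_2(g,\eta)$ is a $G$-grading on $UT_n^{(-)}$ for which each $X_{ij}^\pm$ lies in some homogeneous component, each $X_{ii}^-$ in that of degree $1$, $X_{ii}^+$ in degree $g$, $X_{i,i+1}^-$ in degree $g_i$, and $X_{i,i+1}^+$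 in degree $gg_i$. If $U_h$ ($h\in G$) are its components and $U_g=\mathcal V\oplus\mathbb F I$, a practical type 2 grading $\Gamma_2(t,g,\eta)$, $t\in G$, is a $G$-grading with components $U'_h=U_h$ for $h\ne g,t$, $U'_t=U_t+\mathbb F I$, and $U'_g=\mathcal V$ if $g\neq t$. Such gradings exist (for a suitable $\mathcal V$). Write $\eta\sim_g\eta'$ if $g_i\in\{g_i',gg_i'\}$ for $1\le i\le\lfloor (n-1)/2\rfloor$ and, when $n$ is even, $g_{n/2}=g'_{n/2}$. For all $t,t'\in G$ and all pairs $(g,\eta)$, $(g',\eta')$ as above, and whichever gradings $\Gamma_2(t,g,\eta)$, $\Gamma_2(t',g',\eta')$ with these parameters are taken: 3. $\Gamma_2(t,g,\eta)$ and $\Gamma_2(t',g',\eta')$ are graded isomorphic if and only if $g=g'$, $t=t'$ and $\eta\sim_g\eta'$; 4. $\Gamma_2(t,g,\eta)$ and $\Gamma_2(t',g',\eta')$ are practically graded isomorphic if and only if $g=g'$ and $\eta\sim_g\eta'$. -/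

import Mathlib

/-- A grading of a Lie algebra `L` over `F` by an arbitrary (not necessarily commutative)
multiplicative group `G`: a vector space decomposition `L = ⨁ h, L_h` such that
`[L_h, L_k] ⊆ L_{hk}`. -/
structure LieGrading (F : Type*) (G : Type*) (L : Type*) [Field F] [Group G]
    [LieRing L] [LieAlgebra F L] where
  /-- The homogeneous component of degree `h`. -/
  component : G → Submodule F L
  isInternal : letI := Classical.decEq G
    DirectSum.IsInternal component
  lie_mem : ∀ {h k : G} {x y : L}, x ∈ component h → y ∈ component k →
    ⁅x, y⁆ ∈ component (h * k)

namespace LieGrading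

variable {F G : Type*} [Field F] [Group G]
variable {L₁ L₂ : Type*} [LieRing L₁] [LieAlgebra F L₁] [LieRing L₂] [LieAlgebra F L₂]

/-- Two `G`-graded Lie algebras are graded isomorphic if there is a Lie algebra isomorphism that
sends every homogeneous component into the component of the same degree. -/
def GradedIso (Γ₁ : LieGrading F G L₁) (Γ₂ : LieGrading F G L₂) : Prop :=
  ∃ f : L₁ ≃ₗ⁅F⁆ L₂, ∀ h : G, ∀ x ∈ Γ₁.component h, f x ∈ Γ₂.component h

/-- The degree `h` component of the grading induced on the quotient of `L₁` by its centre. -/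
def centerQuotientComponent (Γ₁ : LieGrading F G L₁) (h : G) :
    Submodule F (L₁ ⧸ LieAlgebra.center F L₁) :=
  (Γ₁.component h).map
    (LieSubmodule.Quotient.mk' (LieAlgebra.center F L₁) : L₁ →ₗ[F] L₁ ⧸ LieAlgebra.center F L₁)

/-- Two `G`-graded Lie algebras are practically graded isomorphic if there is an isomorphism `ψ`
of the ungraded Lie algebras that induces a graded isomorphism `φ` between the quotients by the
centres. -/
def PracticallyGradedIso (Γ₁ : LieGrading F G L₁) (Γ₂ : LieGrading F G L₂) : Prop :=
  ∃ (ψ : L₁ ≃ₗ⁅F⁆ L₂)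
    (φ : (L₁ ⧸ LieAlgebra.center F L₁) ≃ₗ⁅F⁆ (L₂ ⧸ LieAlgebra.center F L₂)),
    (∀ x : L₁, φ (LieSubmodule.Quotient.mk' (LieAlgebra.center F L₁) x) =
      LieSubmodule.Quotient.mk' (LieAlgebra.center F L₂) (ψ x)) ∧
    ∀ h : G, ∀ y ∈ Γ₁.centerQuotientComponent h, φ y ∈ Γ₂.centerQuotientComponent h

end LieGrading

attribute [local instance] LieRing.ofAssociativeRing

/-- The Lie algebra of upper triangular `n × n` matrices over `F`, with bracket `ab - ba`. -/
def UT (F : Type*) [Field F] (n : ℕ) : LieSubalgebra F (Matrix (Fin n) (Fin n) F) where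
  carrier := {A | A.IsUpperTriangular}
  add_mem' := fun ha hb => ha.add hb
  zero_mem' := Matrix.blockTriangular_zero
  smul_mem' := fun c A hA i j hij => by
    rw [Matrix.smul_apply, hA hij, smul_zero]
  lie_mem' := fun ha hb => (ha.mul hb).sub (hb.mul ha)

namespace UT

variable {F G : Type*} [Field F] [Group G] {n : ℕ}

/-- The matrix unit `e_{ij}`, for `i ≤ j`. -/
def e (i j : Fin n) (hij : i ≤ j) : UT F n :=
  ⟨Matrix.single i j 1, by
    intro a b hab
    refine Matrix.single_apply_of_ne _ _ _ _ _ ?_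
    rintro ⟨rfl, rfl⟩
    exact absurd hab (not_lt.mpr hij)⟩

/-- The identity matrix. -/
def one (F : Type*) [Field F] (n : ℕ) : UT F n := ⟨1, Matrix.blockTriangular_one⟩

/-- The subspace `𝓓` of diagonal matrices. -/
def diag (F : Type*) [Field F] (n : ℕ) : Submodule F (UT F n) where
  carrier := {A | (A : Matrix (Fin n) (Fin n) F).IsDiag}
  add_mem' := fun ha hb => ha.add hb
  zero_mem' := Matrix.isDiag_zero
  smul_mem' := fun c _ ha => ha.smul c

/-- The row index `i`, as an index of an `n × n` matrix, of the superdiagonal unit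
`e_{i,i+1}`. -/
def row (i : Fin (n - 1)) : Fin n := ⟨i, by omega⟩

/-- The column index `i + 1` of the superdiagonal unit `e_{i,i+1}`. -/
def col (i : Fin (n - 1)) : Fin n := ⟨i + 1, by omega⟩

lemma row_le_col (i : Fin (n - 1)) : row i ≤ col i := Nat.le_succ (i : ℕ)

/-- `X_{ij}^+ = e_{ij} + e_{n-j+1,n-i+1}` (indices counted from `1`). -/
def Xplus (i j : Fin n) (hij : i ≤ j) : UT F n :=
  e i j hij + e j.rev i.rev (Fin.rev_le_rev.mpr hij)

/-- `X_{ij}^- = e_{ij} - e_{n-j+1,n-i+1}` (indices counted from `1`). -/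
def Xminus (i j : Fin n) (hij : i ≤ j) : UT F n :=
  e i j hij - e j.rev i.rev (Fin.rev_le_rev.mpr hij)

/-- `S = 𝔽·I ⊕ V`, as an internal direct sum of subspaces. -/
def IsIdentityComplement (S V : Submodule F (UT F n)) : Prop :=
  Submodule.span F {one F n} ⊓ V = ⊥ ∧ Submodule.span F {one F n} ⊔ V = S

/-- `Γ` is a practical elementary grading `Γ₁(t, η)`. -/
def IsPracticalElementary (Γ : LieGrading F G (UT F n)) (t : G) (η : Fin (n - 1) → G) : Prop :=
  ∃ V : Submodule F (UT F n), IsIdentityComplement (diag F n) V ∧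
    (∀ i : Fin (n - 1), e (row i) (col i) (row_le_col i) ∈ Γ.component (η i)) ∧
    one F n ∈ Γ.component t ∧
    V ≤ Γ.component 1

/-- `Γ` is a type 2 grading `Γ₂(g, η)`. -/
def IsTypeTwo (Γ : LieGrading F G (UT F n)) (g : G) (η : Fin (n - 1) → G) : Prop :=
  (∀ (i j : Fin n) (hij : i ≤ j), (∃ h, Xplus i j hij ∈ Γ.component h) ∧
    (∃ h, Xminus i j hij ∈ Γ.component h)) ∧
  (∀ i : Fin n, Xminus i i le_rfl ∈ Γ.component 1 ∧ Xplus i i le_rfl ∈ Γ.component g) ∧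
  (∀ i : Fin (n - 1), Xminus (row i) (col i) (row_le_col i) ∈ Γ.component (η i) ∧
    Xplus (row i) (col i) (row_le_col i) ∈ Γ.component (g * η i))

/-- `Γ` is a practical type 2 grading `Γ₂(t, g, η)`: a grading obtained from a type 2 grading
`Γ₂(g, η)`, with components `U_h`, by writing `U_g = V ⊕ 𝔽·I` and moving `I` to degree `t`. -/
def IsPracticalTypeTwo (Γ : LieGrading F G (UT F n)) (t g : G) (η : Fin (n - 1) → G) : Prop :=
  ∃ (U : LieGrading F G (UT F n)) (V : Submodule F (UT F n)),
    IsTypeTwo U g η ∧ IsIdentityComplement (U.component g) V ∧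
    (∀ h, h ≠ g → h ≠ t → Γ.component h = U.component h) ∧
    Γ.component t = U.component t ⊔ Submodule.span F {one F n} ∧
    (g ≠ t → Γ.component g = V)

end UT

/-- The reverse `(g_{n-1}, …, g_1)` of the sequence `(g_1, …, g_{n-1})`. -/
def seqRev {G : Type*} {n : ℕ} (η : Fin (n - 1) → G) : Fin (n - 1) → G := fun i => η i.rev

/-- The relation `η ∼ η'`: equal up to reversal. -/
def SeqEquiv {G : Type*} {n : ℕ} (η η' : Fin (n - 1) → G) : Prop :=
  η = η' ∨ η = seqRev η'

/-- The relation `η ∼_g η'`: for `1 ≤ i ≤ ⌊(n-1)/2⌋` the entry `g_i` is `g_i'` or `g g_i'`, and, if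
`n` is even, `g_{n/2} = g_{n/2}'`. (The entries `g_1, …, g_{n-1}` are indexed by
`Fin (n - 1)`, which counts from `0`, so `g_{i+1}` is `η i`.) -/
def SeqEquivMod {G : Type*} [Group G] {n : ℕ} (g : G) (η η' : Fin (n - 1) → G) : Prop :=
  (∀ i : Fin (n - 1), (i : ℕ) + 1 ≤ (n - 1) / 2 → η i = η' i ∨ η i = g * η' i) ∧
  (∀ i : Fin (n - 1), 2 * ((i : ℕ) + 1) = n → η i = η' i)

/-!
Everything rests on two general facts about gradings and one about automorphisms of `UT F n`.

* `LieGrading.gradedIso_iff_of_center_eq_span`: if the centre is a line, then two gradings are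
  graded isomorphic if and only if they are practically graded isomorphic and their centres have the
  same degree. Indeed a practically graded isomorphism preserves degrees up to central summands;
  these summands are given by a linear map that vanishes on brackets, and subtracting it leaves an
  isomorphism. So only the practically graded isomorphisms have to be classified, and these only see
  the components modulo the centre.

* `LieGrading.component_le_of_generates`: a grading is determined by the degrees of homogeneous
  generators. Generators are the diagonal matrices and the simple root vectors `e_{i,i+1}`, so that
  the gradings in question are known modulo the centre, and an automorphism is practically graded as
  soon as it is so on these generators. The automorphisms needed are `UT.flip`, which is minus the
  reflection in the antidiagonal and reverses `η`, and `UT.conjDiag`, conjugation by a diagonal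
  matrix of signs: it scales `e_{i,i+1}` by a sign, and where this sign and the one at the mirror
  image of `e_{i,i+1}` are opposite it exchanges `X_{i,i+1}^+` and `X_{i,i+1}^-` up to sign, which
  replaces `g_i` by `g g_i`.

* `UT.exists_diagram_symmetry`: an arbitrary automorphism permutes the vectors `e_{i,i+1}` up to
  scalars modulo brackets of matrices with zero diagonal, by a symmetry of the path `A_{n-1}`, and
  permutes the differences of neighbouring diagonal entries by the same symmetry. Comparing
  superdiagonal entries then gives the degrees `g_i` up to reversal, in the type 2 case also up to
  the factor `g`, while the differences of neighbouring diagonal entries give `g`.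

For the existence of the gradings, `UT.elemComponent` puts `e_{ij}` in degree `g_i ⋯ g_{j-1}`, and
`UT.typeTwoComponent` refines this by the eigenspaces of `UT.flip`. `LieGrading.regrade` then moves
the identity matrix to the degree `t`, along a linear functional that vanishes on brackets and, of
all components, is nonzero only on the one that contains the identity matrix.
-/

/-! ### Gradings and the centre -/

namespace LieGrading

section General

variable {F G L L' : Type*} [Field F] [Group G]
variable [LieRing L] [LieAlgebra F L] [LieRing L'] [LieAlgebra F L']

omit [Group G] in
theorem isInternal_of_sum_eq_zero (A : G → Submodule F L)
    (hind : ∀ (s : Finset G) (v : G → L), (∀ h ∈ s, v h ∈ A h) → ∑ h ∈ s, v h = 0 →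
      ∀ h ∈ s, v h = 0)
    (hspan : ∀ x, x ∈ ⨆ h, A h) :
    letI := Classical.decEq G
    DirectSum.IsInternal A :=
  letI := Classical.decEq G
  DirectSum.isInternal_submodule_of_iSupIndep_of_iSup_eq_top
    ((iSupIndep_iff_finsetSum_eq_zero_imp_eq_zero A).2 hind) (eq_top_iff.2 fun x _ => hspan x)

theorem iSup_component (Γ : LieGrading F G L) : ⨆ h, Γ.component h = ⊤ :=
  letI := Classical.decEq G
  Γ.isInternal.submodule_iSup_eq_top

@[elab_as_elim]
theorem induction_on (Γ : LieGrading F G L) {p : L → Prop} (x : L)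
    (hom : ∀ h, ∀ x ∈ Γ.component h, p x) (add : ∀ x y, p x → p y → p (x + y)) : p x :=
  Submodule.iSup_induction Γ.component (motive := p) (by rw [Γ.iSup_component]; trivial) hom
    (hom 1 0 (zero_mem _)) add

/-- The projection of a graded Lie algebra onto its component of degree `h`. -/
noncomputable def proj (Γ : LieGrading F G L) (h : G) : L →ₗ[F] L :=
  letI := Classical.decEq G
  (Γ.component h).subtype ∘ₗ DirectSum.component F G (fun h => Γ.component h) h ∘ₗ
    (LinearEquiv.ofBijective (DirectSum.coeLinearMap Γ.component) Γ.isInternal).symm.toLinearMap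

theorem proj_of_mem (Γ : LieGrading F G L) {h : G} {x : L} (hx : x ∈ Γ.component h) :
    Γ.proj h x = x := by
  let _ := Classical.decEq G
  have := Γ.isInternal.ofBijective_coeLinearMap_of_mem hx
  exact congrArg Subtype.val this

theorem proj_of_mem_ne (Γ : LieGrading F G L) {h k : G} (hk : k ≠ h) {x : L}
    (hx : x ∈ Γ.component k) : Γ.proj h x = 0 := by
  let _ := Classical.decEq G
  have := Γ.isInternal.ofBijective_coeLinearMap_of_mem_ne hk hx
  exact congrArg Subtype.val this

theorem eq_zero_of_mem_of_mem (Γ : LieGrading F G L) {h k : G} (hk : h ≠ k) {x : L}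
    (hx : x ∈ Γ.component h) (hx' : x ∈ Γ.component k) : x = 0 := by
  rw [← Γ.proj_of_mem hx, Γ.proj_of_mem_ne hk.symm hx']

theorem degree_unique (Γ : LieGrading F G L) {h k : G} {x : L} (hx0 : x ≠ 0)
    (hx : x ∈ Γ.component h) (hx' : x ∈ Γ.component k) : h = k := by
  by_contra hk
  exact hx0 (Γ.eq_zero_of_mem_of_mem hk hx hx')

/-- A family of subspaces that respects brackets and contains homogeneous generators, each in the
subspace indexed by its degree, contains all homogeneous elements. Here generation is expressed by
`hgen`: the span `Q` of the homogeneous elements lying in the subspace of their degree is closed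
under brackets, and the hypothesis says that this forces `Q` to be everything. -/
theorem component_le_of_generates (Γ : LieGrading F G L) (P : G → Submodule F L)
    (hP : ∀ h k x y, x ∈ P h → y ∈ P k → ⁅x, y⁆ ∈ P (h * k))
    (hgen : ∀ Q : Submodule F L, (∀ x y, x ∈ Q → y ∈ Q → ⁅x, y⁆ ∈ Q) →
      (∀ h x, x ∈ Γ.component h → x ∈ P h → x ∈ Q) → Q = ⊤) (h : G) :
    Γ.component h ≤ P h := by
  have htop : ⨆ h, Γ.component h ⊓ P h = ⊤ := by
    refine hgen _ (fun x y hx hy => ?_) fun h x hx hx' => Submodule.mem_iSup_of_mem h ⟨hx, hx'⟩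
    induction hx using Submodule.iSup_induction' with
    | zero => simp
    | add x x' _ _ ih ih' => rw [add_lie]; exact add_mem ih ih'
    | mem a x hx =>
      induction hy using Submodule.iSup_induction' with
      | zero => simp
      | add y y' _ _ ih ih' => rw [lie_add]; exact add_mem ih ih'
      | mem b y hy =>
        exact Submodule.mem_iSup_of_mem (a * b) ⟨Γ.lie_mem hx.1 hy.1, hP _ _ _ _ hx.2 hy.2⟩
  intro x hx
  have key : ∀ y : L, Γ.proj h y ∈ P h := fun y => by
    have hy : y ∈ ⨆ h, Γ.component h ⊓ P h := by rw [htop]; trivial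
    induction hy using Submodule.iSup_induction' with
    | zero => simp
    | add y y' _ _ ih ih' => rw [map_add]; exact add_mem ih ih'
    | mem a y hy =>
      rcases eq_or_ne a h with rfl | ha
      · rw [Γ.proj_of_mem hy.1]; exact hy.2
      · rw [Γ.proj_of_mem_ne ha hy.1]; exact zero_mem _
  simpa [Γ.proj_of_mem hx] using key x

theorem map_mem_center (ψ : L ≃ₗ⁅F⁆ L') {c : L} (hc : c ∈ LieAlgebra.center F L) :
    ψ c ∈ LieAlgebra.center F L' := by
  rw [LieModule.mem_maxTrivSubmodule] at hc ⊢
  intro y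
  rw [← ψ.apply_symm_apply y, ← LieEquiv.map_lie, hc, map_zero]

/-- The isomorphism of quotients by the centres induced by an isomorphism of Lie algebras. -/
def centerQuotientEquiv (ψ : L ≃ₗ⁅F⁆ L') :
    (L ⧸ LieAlgebra.center F L) ≃ₗ⁅F⁆ (L' ⧸ LieAlgebra.center F L') :=
  { Submodule.Quotient.equiv (LieAlgebra.center F L).toSubmodule
      (LieAlgebra.center F L').toSubmodule ψ.toLinearEquiv (by
        ext y
        constructor
        · rintro ⟨x, hx, rfl⟩
          exact map_mem_center ψ hx
        · intro hy
          exact ⟨ψ.symm y, map_mem_center ψ.symm hy, ψ.apply_symm_apply y⟩) with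
    map_lie' := by
      rintro ⟨x⟩ ⟨y⟩
      exact congrArg (LieSubmodule.Quotient.mk (N := LieAlgebra.center F L'))
        (LieEquiv.map_lie ψ x y) }

/-- An isomorphism is practically graded when it preserves degrees up to central summands. -/
theorem practicallyGradedIso_iff (Γ : LieGrading F G L) (Γ' : LieGrading F G L') :
    Γ.PracticallyGradedIso Γ' ↔ ∃ ψ : L ≃ₗ⁅F⁆ L', ∀ h, ∀ x ∈ Γ.component h,
      ψ x ∈ Γ'.component h ⊔ (LieAlgebra.center F L').toSubmodule := by
  have mem_iff : ∀ (h : G) (x : L'), (LieSubmodule.Quotient.mk' (LieAlgebra.center F L') x ∈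
      Γ'.centerQuotientComponent h ↔
        x ∈ Γ'.component h ⊔ (LieAlgebra.center F L').toSubmodule) := by
    intro h x
    rw [Submodule.mem_sup]
    constructor
    · rintro ⟨y, hy, hxy⟩
      refine ⟨y, hy, x - y, ?_, by abel⟩
      refine (LieSubmodule.Quotient.mk_eq_zero (N := LieAlgebra.center F L')).1 ?_
      rw [map_sub, sub_eq_zero]
      exact hxy.symm
    · rintro ⟨y, hy, c, hc, rfl⟩
      refine ⟨y, hy, ?_⟩
      have : LieSubmodule.Quotient.mk' (LieAlgebra.center F L') c = 0 :=
        (LieSubmodule.Quotient.mk_eq_zero (N := LieAlgebra.center F L')).2 hc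
      rw [map_add, this, add_zero]
      rfl
  constructor
  · rintro ⟨ψ, φ, hφ, hgr⟩
    refine ⟨ψ, fun h x hx => ?_⟩
    rw [← mem_iff, ← hφ]
    exact hgr h _ ⟨x, hx, rfl⟩
  · rintro ⟨ψ, hψ⟩
    refine ⟨ψ, centerQuotientEquiv ψ, fun _ => rfl, ?_⟩
    rintro h _ ⟨x, hx, rfl⟩
    exact (mem_iff h (ψ x)).2 (hψ h x hx)

theorem GradedIso.practicallyGradedIso {Γ : LieGrading F G L} {Γ' : LieGrading F G L'}
    (H : Γ.GradedIso Γ') : Γ.PracticallyGradedIso Γ' := by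
  obtain ⟨f, hf⟩ := H
  exact (practicallyGradedIso_iff Γ Γ').2 ⟨f, fun h x hx => Submodule.mem_sup_left (hf h x hx)⟩

/-- A linear functional that is `1` on a nonzero homogeneous element `z` and vanishes on the
components of other degrees. -/
theorem exists_functional (Γ : LieGrading F G L) {z : L} {t : G} (hz : z ≠ 0)
    (hzt : z ∈ Γ.component t) : ∃ μ : L →ₗ[F] F, μ z = 1 ∧
      ∀ h ≠ t, ∀ x ∈ Γ.component h, μ x = 0 := by
  obtain ⟨μ, hμ⟩ := Module.Projective.exists_dual_eq_one F hz
  refine ⟨μ ∘ₗ Γ.proj t, by simpa [Γ.proj_of_mem hzt] using hμ, fun h hh x hx => ?_⟩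
  simp [Γ.proj_of_mem_ne hh hx]

/-- If the centre is a line, graded isomorphism amounts to practically graded isomorphism together
with equality of the degrees of the centres: a practically graded isomorphism can be corrected by a
linear map with values in the centre, which vanishes on brackets. -/
theorem gradedIso_iff_of_center_eq_span (Γ : LieGrading F G L) (Γ' : LieGrading F G L') {z : L}
    {z' : L'} {t t' : G} (hz : z ≠ 0) (hz' : z' ≠ 0)
    (hc : (LieAlgebra.center F L).toSubmodule = Submodule.span F {z})
    (hc' : (LieAlgebra.center F L').toSubmodule = Submodule.span F {z'})
    (hzt : z ∈ Γ.component t) (hzt' : z' ∈ Γ'.component t') :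
    Γ.GradedIso Γ' ↔ t = t' ∧ Γ.PracticallyGradedIso Γ' := by
  have hzc : z ∈ LieAlgebra.center F L := by
    rw [← LieSubmodule.mem_toSubmodule, hc]; exact Submodule.mem_span_singleton_self z
  have hzc' : z' ∈ LieAlgebra.center F L' := by
    rw [← LieSubmodule.mem_toSubmodule, hc']; exact Submodule.mem_span_singleton_self z'
  constructor
  · intro H
    refine ⟨?_, H.practicallyGradedIso⟩
    obtain ⟨f, hf⟩ := H
    have h1 : f z ∈ Γ'.component t := hf t z hzt
    have h2 : f z ∈ Submodule.span F {z'} := by rw [← hc']; exact map_mem_center f hzc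
    have h3 : f z ∈ Γ'.component t' := (Submodule.span_singleton_le_iff_mem _ _).2 hzt' h2
    exact Γ'.degree_unique (fun h0 => hz (f.injective (h0.trans (map_zero f).symm))) h1 h3
  · rintro ⟨rfl, H⟩
    obtain ⟨ψ, hψ⟩ := (practicallyGradedIso_iff Γ Γ').1 H
    obtain ⟨μ, hμ, hμ0⟩ := Γ'.exists_functional hz' hzt'
    -- the corrected map: on components of degree `≠ t` subtract the central summand
    let ν : L →ₗ[F] F := μ ∘ₗ ψ.toLinearEquiv.toLinearMap ∘ₗ (LinearMap.id - Γ.proj t)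
    have ν_t : ∀ x ∈ Γ.component t, ν x = 0 := fun x hx => by simp [ν, Γ.proj_of_mem hx]
    have ν_ne : ∀ h ≠ t, ∀ x ∈ Γ.component h, ν x = μ (ψ x) := fun h hh x hx => by
      simp [ν, Γ.proj_of_mem_ne hh hx]
    have hz'0 : ∀ y : L', ⁅y, z'⁆ = 0 := (LieModule.mem_maxTrivSubmodule F L' L' z').1 hzc'
    have hz'0' : ∀ y : L', ⁅z', y⁆ = 0 := fun y => by rw [← lie_skew, hz'0, neg_zero]
    have hdec : ∀ h, ∀ x ∈ Γ.component h, ∃ c : F, ψ x - c • z' ∈ Γ'.component h := by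
      intro h x hx
      have := hψ h x hx
      rw [hc', Submodule.mem_sup] at this
      obtain ⟨y, hy, w, hw, hyw⟩ := this
      obtain ⟨c, rfl⟩ := Submodule.mem_span_singleton.1 hw
      exact ⟨c, by rw [← hyw, add_sub_cancel_right]; exact hy⟩
    -- central summands do not affect brackets, so `ψ ⁅x, y⁆` is homogeneous for homogeneous `x`, `y`
    have ν_lie : ∀ x y : L, ν ⁅x, y⁆ = 0 := by
      intro x y
      refine Γ.induction_on x (fun h x hx => ?_) (fun x x' hx hx' => by
        rw [add_lie, map_add, hx, hx', add_zero])
      refine Γ.induction_on y (fun k y hy => ?_) (fun y y' hy hy' => by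
        rw [lie_add, map_add, hy, hy', add_zero])
      have hxy := Γ.lie_mem hx hy
      rcases eq_or_ne (h * k) t with he | he
      · exact ν_t _ (he ▸ hxy)
      · rw [ν_ne _ he _ hxy]
        obtain ⟨a, ha⟩ := hdec h x hx
        obtain ⟨b, hb⟩ := hdec k y hy
        have hab := Γ'.lie_mem ha hb
        have : ⁅ψ x - a • z', ψ y - b • z'⁆ = ψ ⁅x, y⁆ := by
          simp [hz'0, hz'0', LieEquiv.map_lie]
        rw [this] at hab
        exact hμ0 _ he _ hab
    let f : L →ₗ[F] L' := ψ.toLinearEquiv.toLinearMap - ν.smulRight z'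
    have hf : ∀ x, f x = ψ x - ν x • z' := fun x => rfl
    have hfz : ∀ c : F, f (ψ.symm (c • z')) = c • z' := by
      intro c
      have : ψ.symm (c • z') ∈ Γ.component t := by
        have h1 : ψ.symm (c • z') ∈ Submodule.span F {z} := by
          rw [← hc]
          exact map_mem_center ψ.symm ((LieAlgebra.center F L').smul_mem c hzc')
        exact (Submodule.span_singleton_le_iff_mem _ _).2 hzt h1
      rw [hf, ν_t _ this, ψ.apply_symm_apply, zero_smul, sub_zero]
    have hinj : Function.Injective f := by
      rw [← LinearMap.ker_eq_bot, LinearMap.ker_eq_bot']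
      intro x hx
      have h1 : ψ x = ν x • z' := by rwa [hf, sub_eq_zero] at hx
      have h2 : x = ψ.symm (ν x • z') := by rw [← h1, ψ.symm_apply_apply]
      have h3 := hfz (ν x)
      rw [← h2, hx] at h3
      rw [h2, ← h3, map_zero]
    have hsurj : Function.Surjective f := by
      intro y
      refine ⟨ψ.symm y + ψ.symm (ν (ψ.symm y) • z'), ?_⟩
      rw [map_add, hfz, hf, ψ.apply_symm_apply, sub_add_cancel]
    have hlie : ∀ x y, f ⁅x, y⁆ = ⁅f x, f y⁆ := by
      intro x y
      rw [hf, hf, hf, ν_lie]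
      simp [hz'0, hz'0', LieEquiv.map_lie]
    refine ⟨{ LinearEquiv.ofBijective f ⟨hinj, hsurj⟩ with map_lie' := fun {x y} => hlie x y },
      fun h x hx => ?_⟩
    change f x ∈ _
    obtain ⟨c, hc⟩ := hdec h x hx
    rcases eq_or_ne h t with rfl | hh
    · rw [hf, ν_t x hx, zero_smul, sub_zero]
      simpa using add_mem hc (Submodule.smul_mem _ c hzt')
    · have := hμ0 h hh _ hc
      rw [map_sub, map_smul, hμ, sub_eq_zero] at this
      rw [hf, ν_ne h hh x hx, this]
      simpa using hc

/-- The component of degree `h` of `LieGrading.regrade`. -/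
def regradeComponent (Γ : LieGrading F G L) (z : L) (l : L →ₗ[F] F) (t h : G) :
    Submodule F L where
  carrier := {x | x - l x • z ∈ Γ.component h ∧ (h ≠ t → l x = 0)}
  add_mem' := fun {x y} hx hy => ⟨by
    have := add_mem hx.1 hy.1
    rw [map_add, add_smul]
    convert this using 1
    abel, fun h => by rw [map_add, hx.2 h, hy.2 h, add_zero]⟩
  zero_mem' := by simp
  smul_mem' := fun c x hx => ⟨by
    have := Submodule.smul_mem _ c hx.1
    rwa [smul_sub, smul_smul, ← smul_eq_mul, ← map_smul] at this, fun h => by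
      rw [map_smul, hx.2 h, smul_zero]⟩

/-- Moving a central element `z` of degree `s` to degree `t`: given a functional `l` with `l z = 1`
that vanishes on brackets and on all components except that of degree `s`, the Lie algebra is the
sum of the graded ideal `ker l` and the line through `z`, and the latter may be given any degree. -/
def regrade (Γ : LieGrading F G L) (z : L) (l : L →ₗ[F] F) (s t : G)
    (hzc : z ∈ LieAlgebra.center F L) (hzs : z ∈ Γ.component s) (hlz : l z = 1)
    (hl : ∀ x y : L, l ⁅x, y⁆ = 0) (hls : ∀ h ≠ s, ∀ x ∈ Γ.component h, l x = 0) :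
    LieGrading F G L where
  component := Γ.regradeComponent z l t
  isInternal := by
    refine isInternal_of_sum_eq_zero _ (fun S v hv h0 => ?_) fun x => ?_
    · have hlv : ∀ h ∈ S, l (v h) = 0 := by
        intro h hh
        by_cases ht : h = t
        · have h1 : ∑ k ∈ S, l (v k) = 0 := by rw [← map_sum, h0, map_zero]
          rwa [Finset.sum_eq_single_of_mem h hh fun k hk hkh =>
            (hv k hk).2 (ht ▸ hkh)] at h1
        · exact (hv h hh).2 ht
      let _ := Classical.decEq G
      refine (iSupIndep_iff_finsetSum_eq_zero_imp_eq_zero Γ.component).1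
        Γ.isInternal.submodule_iSupIndep S v (fun h hh => ?_) h0
      have := (hv h hh).1
      rwa [hlv h hh, zero_smul, sub_zero] at this
    · have hz : ∀ c : F, c • z ∈ ⨆ h, Γ.regradeComponent z l t h := fun c =>
        Submodule.smul_mem _ c (Submodule.mem_iSup_of_mem t ⟨by simp [hlz], fun h => (h rfl).elim⟩)
      refine Γ.induction_on x (fun h x hx => ?_) fun x y => add_mem
      rw [← sub_add_cancel x (l x • z)]
      refine add_mem (Submodule.mem_iSup_of_mem h ⟨?_, fun _ => by simp [hlz]⟩) (hz _)
      have : l (x - l x • z) = 0 := by simp [hlz]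
      rw [this, zero_smul, sub_zero]
      by_cases hs : h = s
      · subst hs
        exact sub_mem hx (Submodule.smul_mem _ _ hzs)
      · rwa [hls h hs x hx, zero_smul, sub_zero]
  lie_mem := by
    intro h k x y hx hy
    have hz0 : ∀ y : L, ⁅y, z⁆ = 0 := (LieModule.mem_maxTrivSubmodule F L L z).1 hzc
    have hz0' : ∀ y : L, ⁅z, y⁆ = 0 := fun y => by rw [← lie_skew, hz0, neg_zero]
    refine ⟨?_, fun _ => hl x y⟩
    rw [hl, zero_smul, sub_zero]
    have := Γ.lie_mem hx.1 hy.1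
    simpa [hz0, hz0'] using this

theorem regrade_component_of_ne (Γ : LieGrading F G L) (z : L) (l : L →ₗ[F] F) (s t : G)
    (hls : ∀ h ≠ s, ∀ x ∈ Γ.component h, l x = 0) {h : G} (hs : h ≠ s) (ht : h ≠ t) :
    Γ.regradeComponent z l t h = Γ.component h := by
  ext x
  constructor
  · rintro ⟨hx, hx'⟩
    rwa [hx' ht, zero_smul, sub_zero] at hx
  · intro hx
    have := hls h hs x hx
    exact ⟨by rwa [this, zero_smul, sub_zero], fun _ => this⟩

theorem regrade_component_source (Γ : LieGrading F G L) (z : L) (l : L →ₗ[F] F) (s t : G)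
    (hst : s ≠ t) : Γ.regradeComponent z l t s = Γ.component s ⊓ LinearMap.ker l := by
  ext x
  constructor
  · rintro ⟨hx, hx'⟩
    rw [hx' hst, zero_smul, sub_zero] at hx
    exact ⟨hx, hx' hst⟩
  · rintro ⟨hx, hx'⟩
    have : l x = 0 := hx'
    exact ⟨by rwa [this, zero_smul, sub_zero], fun _ => this⟩

theorem regrade_component_target (Γ : LieGrading F G L) (z : L) (l : L →ₗ[F] F) (s t : G)
    (hzs : z ∈ Γ.component s) (hlz : l z = 1) (hls : ∀ h ≠ s, ∀ x ∈ Γ.component h, l x = 0) :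
    Γ.regradeComponent z l t t = Γ.component t ⊔ Submodule.span F {z} := by
  apply le_antisymm
  · rintro x ⟨hx, -⟩
    rw [← sub_add_cancel x (l x • z)]
    exact add_mem (Submodule.mem_sup_left hx)
      (Submodule.mem_sup_right (Submodule.smul_mem _ _ (Submodule.mem_span_singleton_self z)))
  · refine sup_le (fun x hx => ⟨?_, fun h => (h rfl).elim⟩) ?_
    · rcases eq_or_ne t s with rfl | h
      · exact sub_mem hx (Submodule.smul_mem _ _ hzs)
      · rwa [hls t h x hx, zero_smul, sub_zero]
    · rw [Submodule.span_singleton_le_iff_mem]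
      exact ⟨by simp [hlz], fun h => (h rfl).elim⟩

theorem lie_mem_sup_center (P : G → Submodule F L)
    (hP : ∀ h k x y, x ∈ P h → y ∈ P k → ⁅x, y⁆ ∈ P (h * k)) (h k : G) (x y : L)
    (hx : x ∈ P h ⊔ (LieAlgebra.center F L).toSubmodule)
    (hy : y ∈ P k ⊔ (LieAlgebra.center F L).toSubmodule) : ⁅x, y⁆ ∈ P (h * k) := by
  obtain ⟨x, hx', a, ha, rfl⟩ := Submodule.mem_sup.1 hx
  obtain ⟨y, hy', b, hb, rfl⟩ := Submodule.mem_sup.1 hy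
  have ha' : ∀ y : L, ⁅a, y⁆ = 0 := fun y => by
    rw [← lie_skew, (LieModule.mem_maxTrivSubmodule F L L a).1 ha, neg_zero]
  have hb' : ∀ y : L, ⁅y, b⁆ = 0 := (LieModule.mem_maxTrivSubmodule F L L b).1 hb
  simpa [ha', hb'] using hP h k x y hx' hy'

/-- Practically graded isomorphism only depends on the components modulo the centre. -/
theorem PracticallyGradedIso.congr {Γ U : LieGrading F G L} {Γ' U' : LieGrading F G L'}
    (H : Γ.PracticallyGradedIso Γ')
    (h : ∀ k, Γ.component k ⊔ (LieAlgebra.center F L).toSubmodule =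
      U.component k ⊔ (LieAlgebra.center F L).toSubmodule)
    (h' : ∀ k, Γ'.component k ⊔ (LieAlgebra.center F L').toSubmodule =
      U'.component k ⊔ (LieAlgebra.center F L').toSubmodule) :
    U.PracticallyGradedIso U' := by
  obtain ⟨ψ, hψ⟩ := (practicallyGradedIso_iff Γ Γ').1 H
  refine (practicallyGradedIso_iff U U').2 ⟨ψ, fun k x hx => ?_⟩
  have hx' : x ∈ Γ.component k ⊔ (LieAlgebra.center F L).toSubmodule := by
    rw [h]
    exact Submodule.mem_sup_left hx
  obtain ⟨y, hy, c, hc, rfl⟩ := Submodule.mem_sup.1 hx'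
  rw [← h', map_add]
  exact add_mem (hψ k y hy) (Submodule.mem_sup_right (map_mem_center ψ hc))

end General

end LieGrading

/-! ### Upper triangular matrices -/

namespace UT

variable {F : Type*} [Field F] {n : ℕ}

theorem apply_of_lt (x : UT F n) {i j : Fin n} (h : j < i) :
    (x : Matrix (Fin n) (Fin n) F) i j = 0 := x.2 h

theorem ext_apply {x y : UT F n} (h : ∀ i j, i ≤ j →
    (x : Matrix (Fin n) (Fin n) F) i j = (y : Matrix (Fin n) (Fin n) F) i j) : x = y := by
  ext i j
  rcases le_or_gt i j with hij | hij
  · exact h i j hij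
  · rw [apply_of_lt x hij, apply_of_lt y hij]

theorem coe_lie (x y : UT F n) : ((⁅x, y⁆ : UT F n) : Matrix (Fin n) (Fin n) F) =
    (x : Matrix (Fin n) (Fin n) F) * y - (y : Matrix (Fin n) (Fin n) F) * x := rfl

theorem coe_e (i j : Fin n) (hij : i ≤ j) :
    (e (F := F) i j hij : Matrix (Fin n) (Fin n) F) = Matrix.single i j 1 := rfl

theorem e_apply (i j : Fin n) (hij : i ≤ j) (a b : Fin n) :
    (e (F := F) i j hij : Matrix (Fin n) (Fin n) F) a b = if i = a ∧ j = b then 1 else 0 := by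
  rw [coe_e, Matrix.single_apply]

theorem one_apply (i j : Fin n) :
    (one F n : Matrix (Fin n) (Fin n) F) i j = if i = j then 1 else 0 := Matrix.one_apply

theorem e_mem_diag (i : Fin n) : e i i le_rfl ∈ diag F n := by
  intro a b hab
  rw [e_apply, if_neg]
  rintro ⟨rfl, rfl⟩
  exact hab rfl

theorem one_mem_diag : one F n ∈ diag F n := Matrix.isDiag_one

theorem mul_apply_self (x y : UT F n) (i : Fin n) :
    ((x : Matrix (Fin n) (Fin n) F) * (y : Matrix (Fin n) (Fin n) F)) i i =
      (x : Matrix (Fin n) (Fin n) F) i i * (y : Matrix (Fin n) (Fin n) F) i i := by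
  rw [Matrix.mul_apply, Finset.sum_eq_single_of_mem i (Finset.mem_univ i)]
  intro k _ hk
  rcases lt_or_gt_of_ne hk with h | h
  · rw [apply_of_lt x h, zero_mul]
  · rw [apply_of_lt y h, mul_zero]

theorem mul_apply_row_col (x y : UT F n) (k : Fin (n - 1)) :
    ((x : Matrix (Fin n) (Fin n) F) * (y : Matrix (Fin n) (Fin n) F)) (row k) (col k) =
      (x : Matrix (Fin n) (Fin n) F) (row k) (row k) *
        (y : Matrix (Fin n) (Fin n) F) (row k) (col k) +
      (x : Matrix (Fin n) (Fin n) F) (row k) (col k) *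
        (y : Matrix (Fin n) (Fin n) F) (col k) (col k) := by
  have hne : row k ≠ col k := by simp [row, col, Fin.ext_iff]
  rw [Matrix.mul_apply, Fintype.sum_eq_add (row k) (col k) hne]
  rintro j ⟨h1, h2⟩
  have h : j < row k ∨ col k < j := by
    simp only [row, col, ne_eq, Fin.ext_iff, Fin.lt_def] at *
    omega
  rcases h with h | h
  · rw [apply_of_lt x h, zero_mul]
  · rw [apply_of_lt y h, mul_zero]

/-- The coordinate functional of the superdiagonal unit `e_{k,k+1}`. -/
def superdiag (k : Fin (n - 1)) : UT F n →ₗ[F] F where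
  toFun x := (x : Matrix (Fin n) (Fin n) F) (row k) (col k)
  map_add' _ _ := rfl
  map_smul' _ _ := rfl

/-- The simple root `x ↦ x_{k,k} - x_{k+1,k+1}`, as a functional on all of `UT F n`. -/
def simpleRoot (k : Fin (n - 1)) : UT F n →ₗ[F] F where
  toFun x := (x : Matrix (Fin n) (Fin n) F) (row k) (row k) -
    (x : Matrix (Fin n) (Fin n) F) (col k) (col k)
  map_add' _ _ := add_sub_add_comm ..
  map_smul' c _ := (mul_sub c _ _).symm

/-- The simple root vector `e_{k,k+1}`. -/
def rootVec (F : Type*) [Field F] {n : ℕ} (k : Fin (n - 1)) : UT F n :=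
  e (row k) (col k) (row_le_col k)

theorem superdiag_apply (k : Fin (n - 1)) (x : UT F n) :
    superdiag k x = (x : Matrix (Fin n) (Fin n) F) (row k) (col k) := rfl

theorem simpleRoot_apply (k : Fin (n - 1)) (x : UT F n) :
    simpleRoot k x = (x : Matrix (Fin n) (Fin n) F) (row k) (row k) -
      (x : Matrix (Fin n) (Fin n) F) (col k) (col k) := rfl

theorem lie_apply_self (x y : UT F n) (i : Fin n) :
    ((⁅x, y⁆ : UT F n) : Matrix (Fin n) (Fin n) F) i i = 0 := by
  rw [coe_lie, Matrix.sub_apply, mul_apply_self, mul_apply_self, mul_comm, sub_self]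

theorem superdiag_lie (k : Fin (n - 1)) (x y : UT F n) :
    superdiag k ⁅x, y⁆ = simpleRoot k x * superdiag k y - simpleRoot k y * superdiag k x := by
  rw [superdiag_apply, coe_lie, Matrix.sub_apply, mul_apply_row_col, mul_apply_row_col]
  simp only [superdiag_apply, simpleRoot_apply]
  ring

theorem superdiag_rootVec (k j : Fin (n - 1)) :
    superdiag k (rootVec F j) = if j = k then 1 else 0 := by
  rw [superdiag_apply, rootVec, e_apply]
  congr 1
  simp [row, col, Fin.ext_iff]

theorem lie_e_e (i j k : Fin n) (hij : i ≤ j) (hjk : j ≤ k) (hik : i < k) :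
    ⁅e (F := F) i j hij, e (F := F) j k hjk⁆ = e (F := F) i k hik.le := by
  apply Subtype.ext
  rw [coe_lie, coe_e, coe_e, coe_e, Matrix.single_mul_single_same,
    Matrix.single_mul_single_of_ne _ _ _ _ hik.ne', mul_one, sub_zero]

theorem lie_e_e_of_ne (i j k l : Fin n) (hij : i ≤ j) (hkl : k ≤ l) (hjk : j ≠ k) (hli : l ≠ i) :
    ⁅e (F := F) i j hij, e (F := F) k l hkl⁆ = 0 := by
  apply Subtype.ext
  rw [coe_lie, coe_e, coe_e, Matrix.single_mul_single_of_ne _ _ _ _ hjk,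
    Matrix.single_mul_single_of_ne _ _ _ _ hli, sub_zero]
  rfl

theorem sum_apply {ι : Type*} (S : Finset ι) (f : ι → UT F n) (i j : Fin n) :
    ((∑ a ∈ S, f a : UT F n) : Matrix (Fin n) (Fin n) F) i j =
      ∑ a ∈ S, (f a : Matrix (Fin n) (Fin n) F) i j := by
  have : ((∑ a ∈ S, f a : UT F n) : Matrix (Fin n) (Fin n) F) =
      ∑ a ∈ S, (f a : Matrix (Fin n) (Fin n) F) := map_sum (UT F n).subtype f S
  rw [this, Matrix.sum_apply]

theorem eq_sum_e (x : UT F n) : x = ∑ i, ∑ j, if h : i ≤ j then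
    (x : Matrix (Fin n) (Fin n) F) i j • e (F := F) i j h else 0 := by
  apply ext_apply
  intro a b hab
  have key : ∀ i j, (((if h : i ≤ j then (x : Matrix (Fin n) (Fin n) F) i j • e (F := F) i j h
      else 0) : UT F n) : Matrix (Fin n) (Fin n) F) a b =
      if i = a ∧ j = b then (x : Matrix (Fin n) (Fin n) F) a b else 0 := by
    intro i j
    by_cases h : i ≤ j
    · rw [dif_pos h]
      change (x : Matrix (Fin n) (Fin n) F) i j *
        (e (F := F) i j h : Matrix (Fin n) (Fin n) F) a b = _
      rw [e_apply]
      by_cases h' : i = a ∧ j = b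
      · obtain ⟨rfl, rfl⟩ := h'
        simp
      · rw [if_neg h', if_neg h', mul_zero]
    · rw [dif_neg h, if_neg]
      · rfl
      · rintro ⟨rfl, rfl⟩
        exact h hab
  rw [sum_apply]
  simp_rw [sum_apply, key, ite_and]
  simp

/-- A subspace containing the matrix units above the diagonal contains the matrices with zero
diagonal. -/
theorem mem_of_diag_eq_zero (Q : Submodule F (UT F n))
    (hQ : ∀ (i j : Fin n) (h : i < j), e i j h.le ∈ Q) (x : UT F n)
    (hx : ∀ i, (x : Matrix (Fin n) (Fin n) F) i i = 0) : x ∈ Q := by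
  rw [eq_sum_e x]
  refine Submodule.sum_mem _ fun i _ => Submodule.sum_mem _ fun j _ => ?_
  split_ifs with h
  · rcases h.eq_or_lt with rfl | h'
    · rw [hx, zero_smul]
      exact zero_mem _
    · exact Submodule.smul_mem _ _ (hQ i j h')
  · exact zero_mem _

theorem eq_top_of_e_mem (Q : Submodule F (UT F n))
    (hQ : ∀ (i j : Fin n) (h : i ≤ j), e i j h ∈ Q) : Q = ⊤ := by
  refine eq_top_iff.2 fun x _ => ?_
  rw [eq_sum_e x]
  refine Submodule.sum_mem _ fun i _ => Submodule.sum_mem _ fun j _ => ?_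
  split_ifs with h
  · exact Submodule.smul_mem _ _ (hQ i j h)
  · exact zero_mem _

/-- The diagonal units and the simple root vectors generate `UT F n` as a Lie algebra. -/
theorem eq_top_of_generators_mem (Q : Submodule F (UT F n))
    (hlie : ∀ x y, x ∈ Q → y ∈ Q → ⁅x, y⁆ ∈ Q)
    (hdiag : ∀ i : Fin n, e i i le_rfl ∈ Q) (hroot : ∀ k : Fin (n - 1), rootVec F k ∈ Q) :
    Q = ⊤ := by
  have key : ∀ (m : ℕ) (i j : Fin n) (h : i ≤ j), (j : ℕ) = i + m → e i j h ∈ Q := by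
    intro m
    induction m with
    | zero =>
      intro i j h hm
      obtain rfl : i = j := Fin.ext (by omega)
      exact hdiag i
    | succ m ih =>
      intro i j h hm
      obtain ⟨k, hk⟩ : ∃ k : Fin (n - 1), (k : ℕ) = i + m := ⟨⟨i + m, by omega⟩, rfl⟩
      have hik : i ≤ row k := Fin.le_def.2 (by simp [row, hk])
      obtain rfl : j = col k := Fin.ext (by simp [col, hk, hm]; omega)
      rw [← lie_e_e i (row k) (col k) hik (row_le_col k) (Fin.lt_def.2 (by omega))]
      exact hlie _ _ (ih i (row k) hik hk) (hroot k)
  exact eq_top_of_e_mem Q fun i j h => key (j - i) i j h (by have := Fin.le_def.1 h; omega)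

theorem one_mem_center : one F n ∈ LieAlgebra.center F (UT F n) := by
  refine (LieModule.mem_maxTrivSubmodule F _ _ _).2 fun y => ?_
  apply Subtype.ext
  rw [coe_lie]
  simp [one]

theorem center_eq_span (hn : 0 < n) :
    (LieAlgebra.center F (UT F n)).toSubmodule = Submodule.span F {one F n} := by
  apply le_antisymm
  · intro x hx
    have hx' : ∀ y : UT F n, ⁅y, x⁆ = 0 := (LieModule.mem_maxTrivSubmodule F _ _ x).1 hx
    have entry : ∀ (y : UT F n) (i j : Fin n),
        ((y : Matrix (Fin n) (Fin n) F) * (x : Matrix (Fin n) (Fin n) F)) i j =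
        ((x : Matrix (Fin n) (Fin n) F) * (y : Matrix (Fin n) (Fin n) F)) i j := by
      intro y i j
      have := congrArg (fun z : UT F n => (z : Matrix (Fin n) (Fin n) F) i j) (hx' y)
      simp only [coe_lie, Matrix.sub_apply] at this
      exact sub_eq_zero.1 this
    have hoff : ∀ i j : Fin n, i < j → (x : Matrix (Fin n) (Fin n) F) i j = 0 := by
      intro i j hij
      have := entry (e i i le_rfl) i j
      rw [coe_e, Matrix.single_mul_apply_same, Matrix.mul_single_apply_of_ne _ _ _ _ _ hij.ne',
        one_mul] at this
      exact this
    have hdiag : ∀ j : Fin n, (x : Matrix (Fin n) (Fin n) F) ⟨0, hn⟩ ⟨0, hn⟩ =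
        (x : Matrix (Fin n) (Fin n) F) j j := by
      intro j
      have hj : (⟨0, hn⟩ : Fin n) ≤ j := Fin.le_def.2 (Nat.zero_le _)
      have := entry (e ⟨0, hn⟩ j hj) ⟨0, hn⟩ j
      rw [coe_e, Matrix.single_mul_apply_same, Matrix.mul_single_apply_same, one_mul,
        mul_one] at this
      exact this.symm
    refine Submodule.mem_span_singleton.2 ⟨(x : Matrix (Fin n) (Fin n) F) ⟨0, hn⟩ ⟨0, hn⟩, ?_⟩
    apply ext_apply
    intro i j hij
    change _ * (one F n : Matrix (Fin n) (Fin n) F) i j = _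
    rw [one_apply]
    split_ifs with h
    · subst h
      rw [mul_one, hdiag]
    · rw [mul_zero, hoff i j (lt_of_le_of_ne hij h)]
  · exact (Submodule.span_singleton_le_iff_mem _ _).2 one_mem_center

theorem identity_ne_zero (hn : 0 < n) : one F n ≠ 0 := by
  intro h
  have := congrArg (fun z : UT F n => (z : Matrix (Fin n) (Fin n) F) ⟨0, hn⟩ ⟨0, hn⟩) h
  simp only [one_apply, if_true] at this
  exact one_ne_zero this

/-- The automorphism `x ↦ -x^τ`, where `τ` is the reflection in the antidiagonal. -/
def flip (F : Type*) [Field F] (n : ℕ) : UT F n ≃ₗ⁅F⁆ UT F n where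
  toFun x := ⟨fun i j => -(x : Matrix (Fin n) (Fin n) F) j.rev i.rev, fun i j h => by
    have : (x : Matrix (Fin n) (Fin n) F) j.rev i.rev = 0 := apply_of_lt x (Fin.rev_lt_rev.2 h)
    simp [this]⟩
  map_add' x y := by
    ext i j
    exact neg_add _ _
  map_smul' c x := by
    ext i j
    exact (mul_neg c _).symm
  map_lie' {x y} := by
    ext i j
    simp only [coe_lie, Matrix.sub_apply, Matrix.mul_apply]
    rw [neg_sub]
    congr 1
    · rw [← Equiv.sum_comp Fin.revPerm]
      refine Finset.sum_congr rfl fun k _ => ?_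
      simp [mul_comm]
    · rw [← Equiv.sum_comp Fin.revPerm]
      refine Finset.sum_congr rfl fun k _ => ?_
      simp [mul_comm]
  invFun x := ⟨fun i j => -(x : Matrix (Fin n) (Fin n) F) j.rev i.rev, fun i j h => by
    have : (x : Matrix (Fin n) (Fin n) F) j.rev i.rev = 0 := apply_of_lt x (Fin.rev_lt_rev.2 h)
    simp [this]⟩
  left_inv x := by
    ext i j
    simp
  right_inv x := by
    ext i j
    simp

theorem flip_apply (x : UT F n) (i j : Fin n) :
    (flip F n x : Matrix (Fin n) (Fin n) F) i j = -(x : Matrix (Fin n) (Fin n) F) j.rev i.rev :=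
  rfl

theorem flip_e (i j : Fin n) (hij : i ≤ j) :
    flip F n (e i j hij) = -e j.rev i.rev (Fin.rev_le_rev.mpr hij) := by
  ext a b
  rw [flip_apply, e_apply]
  change _ = -(e (F := F) j.rev i.rev _ : Matrix (Fin n) (Fin n) F) a b
  rw [e_apply]
  simp only [Fin.rev_eq_iff, eq_comm (a := i), eq_comm (a := j), and_comm]

/-- Conjugation by the diagonal matrix with entries `s i`, all of them square roots of `1`. -/
def conjDiag (s : Fin n → F) (hs : ∀ i, s i * s i = 1) : UT F n ≃ₗ⁅F⁆ UT F n where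
  toFun x := ⟨fun i j => s i * s j * (x : Matrix (Fin n) (Fin n) F) i j, fun i j h => by
    have : (x : Matrix (Fin n) (Fin n) F) i j = 0 := apply_of_lt x h
    simp [this]⟩
  map_add' x y := by
    ext i j
    exact mul_add _ _ _
  map_smul' c x := by
    ext i j
    exact mul_left_comm _ c _
  map_lie' {x y} := by
    ext i j
    have key : ∀ a b k, s i * s j * (a * b) = s i * s k * a * (s k * s j * b) := fun a b k => by
      linear_combination (-s i * s j * a * b) * hs k
    simp only [coe_lie, Matrix.sub_apply, Matrix.mul_apply, mul_sub, Finset.mul_sum]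
    congr 1 <;> exact Finset.sum_congr rfl fun k _ => key _ _ k
  invFun x := ⟨fun i j => s i * s j * (x : Matrix (Fin n) (Fin n) F) i j, fun i j h => by
    have : (x : Matrix (Fin n) (Fin n) F) i j = 0 := apply_of_lt x h
    simp [this]⟩
  left_inv x := by
    ext i j
    change s i * s j * (s i * s j * _) = _
    linear_combination (s j * s j * (x : Matrix (Fin n) (Fin n) F) i j) * hs i +
      (x : Matrix (Fin n) (Fin n) F) i j * hs j
  right_inv x := by
    ext i j
    change s i * s j * (s i * s j * _) = _
    linear_combination (s j * s j * (x : Matrix (Fin n) (Fin n) F) i j) * hs i +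
      (x : Matrix (Fin n) (Fin n) F) i j * hs j

theorem conjDiag_e (s : Fin n → F) (hs : ∀ i, s i * s i = 1) (i j : Fin n) (hij : i ≤ j) :
    conjDiag s hs (e i j hij) = (s i * s j) • e i j hij := by
  ext a b
  change s a * s b * (e (F := F) i j hij : Matrix (Fin n) (Fin n) F) a b =
    (s i * s j) * (e (F := F) i j hij : Matrix (Fin n) (Fin n) F) a b
  rw [e_apply]
  split_ifs with h
  · rw [h.1, h.2]
  · simp

end UT

/-! ### Automorphisms modulo the square of the nilradical -/

/-- An injective self-map of a finite path that sends neighbours to neighbours is the identity or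
the reversal. -/
theorem Fin.eq_id_or_eq_rev_of_adjacent {m : ℕ} (τ : Fin m → Fin m) (hinj : Function.Injective τ)
    (hadj : ∀ k k' : Fin m, (k' : ℕ) = k + 1 →
      (τ k' : ℕ) = τ k + 1 ∨ (τ k : ℕ) = τ k' + 1) : τ = id ∨ τ = Fin.rev := by
  rcases Nat.lt_or_ge m 2 with hm | hm
  · left
    funext k
    exact Fin.ext (by have := k.2; have := (τ k).2; simp only [id]; omega)
  have h0 : 0 < m := by omega
  have step : ∀ j (hj : j + 2 < m), ((τ ⟨j, by omega⟩ : ℕ) ≠ τ ⟨j + 2, hj⟩) := by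
    intro j hj h
    have := Fin.ext_iff.1 (hinj (Fin.ext h))
    simp at this
  rcases hadj ⟨0, h0⟩ ⟨1, by omega⟩ rfl with h | h
  · left
    have up : ∀ j (hj : j + 1 < m), (τ ⟨j + 1, hj⟩ : ℕ) = τ ⟨j, by omega⟩ + 1 := by
      intro j
      induction j with
      | zero => intro hj; exact h
      | succ j ih =>
        intro hj
        have h1 := ih (by omega)
        have h2 := hadj ⟨j + 1, by omega⟩ ⟨j + 2, hj⟩ rfl
        have h3 := step j hj
        change (τ ⟨j + 2, hj⟩ : ℕ) = τ ⟨j + 1, _⟩ + 1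
        omega
    have all : ∀ j (hj : j < m), (τ ⟨j, hj⟩ : ℕ) = τ ⟨0, h0⟩ + j := by
      intro j
      induction j with
      | zero => intro hj; rfl
      | succ j ih => intro hj; rw [up j hj, ih (by omega)]; rfl
    funext k
    refine Fin.ext ?_
    have h1 := all (m - 1) (by omega)
    have h2 := (τ ⟨m - 1, by omega⟩).2
    have h3 := all k k.2
    simp only [Fin.eta, id] at *
    omega
  · right
    have down : ∀ j (hj : j + 1 < m), (τ ⟨j, by omega⟩ : ℕ) = τ ⟨j + 1, hj⟩ + 1 := by
      intro j
      induction j with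
      | zero => intro hj; exact h
      | succ j ih =>
        intro hj
        have h1 := ih (by omega)
        have h2 := hadj ⟨j + 1, by omega⟩ ⟨j + 2, hj⟩ rfl
        have h3 := step j hj
        change (τ ⟨j + 1, _⟩ : ℕ) = τ ⟨j + 2, hj⟩ + 1
        omega
    have all : ∀ j (hj : j < m), (τ ⟨0, h0⟩ : ℕ) = τ ⟨j, hj⟩ + j := by
      intro j
      induction j with
      | zero => intro hj; rfl
      | succ j ih =>
        intro hj
        have h1 := down j hj
        have h2 := ih (by omega)
        omega
    funext k
    refine Fin.ext ?_
    have h1 := all (m - 1) (by omega)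
    have h2 := (τ ⟨0, h0⟩).2
    have h3 := all k k.2
    simp only [Fin.eta, Fin.val_rev] at *
    omega

namespace UT

variable {F : Type*} [Field F] {n : ℕ}

/-- For matrices with zero diagonal the entries two places above the diagonal of a product only
involve the superdiagonals. -/
theorem mul_apply_of_diag_eq_zero (x y : UT F n)
    (hx : ∀ i, (x : Matrix (Fin n) (Fin n) F) i i = 0)
    (hy : ∀ i, (y : Matrix (Fin n) (Fin n) F) i i = 0) (k k' : Fin (n - 1))
    (hk : (k' : ℕ) = k + 1) :
    ((x : Matrix (Fin n) (Fin n) F) * (y : Matrix (Fin n) (Fin n) F)) (row k) (col k') =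
      superdiag k x * superdiag k' y := by
  have hck : col k = row k' := Fin.ext hk.symm
  rw [Matrix.mul_apply, Finset.sum_eq_single_of_mem (col k) (Finset.mem_univ _)]
  · rw [superdiag_apply, superdiag_apply, hck]
  · intro j _ hj
    have h : j < row k ∨ j = row k ∨ j = col k' ∨ col k' < j := by
      simp only [row, col, ne_eq, Fin.ext_iff, Fin.lt_def] at *
      omega
    rcases h with h | rfl | rfl | h
    · rw [apply_of_lt x h, zero_mul]
    · rw [hx, zero_mul]
    · rw [hy, mul_zero]
    · rw [apply_of_lt y h, mul_zero]

theorem e_eq_lie (i j : Fin n) (h : i < j) :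
    e (F := F) i j h.le = ⁅e (F := F) i i le_rfl, e i j h.le⁆ :=
  (lie_e_e i i j le_rfl h.le h).symm

variable (ψ : UT F n ≃ₗ⁅F⁆ UT F n)

theorem map_e_apply_self (i j : Fin n) (h : i < j) (k : Fin n) :
    (ψ (e i j h.le) : Matrix (Fin n) (Fin n) F) k k = 0 := by
  rw [e_eq_lie i j h, LieEquiv.map_lie, lie_apply_self]

theorem simpleRoot_map_e (i j : Fin n) (h : i < j) (k : Fin (n - 1)) :
    simpleRoot k (ψ (e i j h.le)) = 0 := by
  rw [simpleRoot_apply, map_e_apply_self ψ i j h, map_e_apply_self ψ i j h, sub_zero]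

/-- An automorphism acts on the matrices with zero diagonal, modulo brackets of two such, through
its effect on the simple root vectors. -/
theorem superdiag_map (k : Fin (n - 1)) (x : UT F n)
    (hx : ∀ i, (x : Matrix (Fin n) (Fin n) F) i i = 0) :
    superdiag k (ψ x) = ∑ j, superdiag j x * superdiag k (ψ (rootVec F j)) := by
  let Λ : UT F n →ₗ[F] F := superdiag k ∘ₗ ψ.toLinearEquiv.toLinearMap -
    ∑ j, (superdiag k (ψ (rootVec F j))) • superdiag j
  have hΛ : ∀ y, Λ y =
      superdiag k (ψ y) - ∑ j, superdiag j y * superdiag k (ψ (rootVec F j)) := by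
    intro y
    simp [Λ, mul_comm]
  suffices h : x ∈ LinearMap.ker Λ by
    rw [LinearMap.mem_ker, hΛ, sub_eq_zero] at h
    exact h
  refine mem_of_diag_eq_zero _ (fun i j hij => ?_) x hx
  rw [LinearMap.mem_ker, hΛ, sub_eq_zero]
  by_cases hj : (j : ℕ) = i + 1
  · have hi : (i : ℕ) < n - 1 := by omega
    obtain ⟨l, rfl, rfl⟩ : ∃ l : Fin (n - 1), i = row l ∧ j = col l :=
      ⟨⟨i, hi⟩, rfl, Fin.ext hj⟩
    change superdiag k (ψ (rootVec F l)) =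
      ∑ m, superdiag m (rootVec F l) * superdiag k (ψ (rootVec F m))
    simp [superdiag_rootVec]
  · have hlt := Fin.lt_def.1 hij
    have hik : i < ⟨i + 1, by omega⟩ := Fin.lt_def.2 (Nat.lt_succ_self _)
    have hkj : (⟨i + 1, by omega⟩ : Fin n) < j := Fin.lt_def.2 (by simp only; omega)
    rw [← lie_e_e i ⟨i + 1, by omega⟩ j hik.le hkj.le hij, LieEquiv.map_lie, superdiag_lie,
      simpleRoot_map_e ψ _ _ hik, simpleRoot_map_e ψ _ _ hkj, zero_mul, zero_mul, sub_zero,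
      Finset.sum_eq_zero]
    intro m _
    have h1 : simpleRoot m (e (F := F) i ⟨i + 1, by omega⟩ hik.le) = 0 :=
      simpleRoot_map_e LieEquiv.refl _ _ hik m
    have h2 : simpleRoot m (e (F := F) ⟨i + 1, by omega⟩ j hkj.le) = 0 :=
      simpleRoot_map_e LieEquiv.refl _ _ hkj m
    rw [superdiag_lie, h1, h2]
    simp

theorem row_lt_col (k : Fin (n - 1)) : row k < col k := Nat.lt_succ_self (k : ℕ)

/-- If `e_{k,k+1}` occurs in the image of `e_{j,j+1}`, the corresponding weights agree: compare the
images of `⁅x, e_{j,j+1}⁆`. -/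
theorem simpleRoot_map (k j : Fin (n - 1)) (h : superdiag k (ψ (rootVec F j)) ≠ 0) (x : UT F n) :
    simpleRoot k (ψ x) = simpleRoot j x := by
  have h1 := superdiag_map ψ k ⁅x, rootVec F j⁆ (lie_apply_self _ _)
  have h2 : ∀ m, simpleRoot m (rootVec F j) = 0 := fun m =>
    simpleRoot_map_e LieEquiv.refl _ _ (row_lt_col j) m
  have h3 : simpleRoot k (ψ (rootVec F j)) = 0 := simpleRoot_map_e ψ _ _ (row_lt_col j) k
  rw [LieEquiv.map_lie, superdiag_lie, h3] at h1
  simp only [superdiag_lie, h2, superdiag_rootVec, zero_mul, sub_zero, mul_ite, mul_one, mul_zero,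
    ite_mul, Finset.sum_ite_eq, Finset.mem_univ, if_true] at h1
  exact mul_right_cancel₀ h h1

/-- The fundamental coweights are dual to the simple roots, in every characteristic. -/
theorem exists_coweight (k : Fin (n - 1)) : ∃ x : UT F n, simpleRoot k x = 1 ∧
    ∀ j ≠ k, simpleRoot j x = 0 := by
  refine ⟨⟨Matrix.diagonal fun i => if (i : ℕ) ≤ k then 1 else 0,
    fun i j h => Matrix.diagonal_apply_ne _ (ne_of_gt h)⟩, ?_, fun j hj => ?_⟩
  · simp [simpleRoot_apply, row, col]
  · have hj' : (j : ℕ) ≠ k := fun h => hj (Fin.ext h)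
    simp only [simpleRoot_apply, row, col, Matrix.diagonal_apply_eq]
    split_ifs <;> first | omega | simp

theorem exists_superdiag_ne_zero (k : Fin (n - 1)) :
    ∃ j, superdiag k (ψ (rootVec F j)) ≠ 0 := by
  by_contra! H
  have h := superdiag_map ψ k (ψ.symm (rootVec F k))
    (map_e_apply_self ψ.symm _ _ (row_lt_col k))
  rw [ψ.apply_symm_apply, superdiag_rootVec, if_pos rfl] at h
  simp [H] at h

/-- Modulo brackets of matrices with zero diagonal, an automorphism of `UT F n` permutes the simple
root vectors up to scalars, and it does so by a symmetry of the Dynkin diagram `A_{n-1}`: the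
weights of the root vectors under the diagonal matrices are distinct, and root vectors that are not
neighbours commute. -/
theorem exists_diagram_symmetry : ∃ τ : Fin (n - 1) → Fin (n - 1), (τ = id ∨ τ = Fin.rev) ∧
    (∀ k j, superdiag k (ψ (rootVec F j)) ≠ 0 ↔ j = τ k) ∧
    ∀ k x, simpleRoot k (ψ x) = simpleRoot (τ k) x := by
  choose τ hτ using exists_superdiag_ne_zero ψ
  have hroot : ∀ k x, simpleRoot k (ψ x) = simpleRoot (τ k) x :=
    fun k x => simpleRoot_map ψ k (τ k) (hτ k) x
  -- a coweight separates the weight of `e_{τ k}` from all the others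
  have huniq : ∀ k j, superdiag k (ψ (rootVec F j)) ≠ 0 ↔ j = τ k := by
    refine fun k j => ⟨fun h => ?_, fun h => h ▸ hτ k⟩
    by_contra hne
    obtain ⟨x, hx, hx'⟩ := exists_coweight (F := F) (τ k)
    have h1 := hroot k x
    rw [simpleRoot_map ψ k j h, hx, hx' j hne] at h1
    exact zero_ne_one h1
  have hinj : Function.Injective τ := by
    intro k l hkl
    by_contra hne
    obtain ⟨x, hx, hx'⟩ := exists_coweight (F := F) k
    have h1 := hroot k (ψ.symm x)
    have h2 := hroot l (ψ.symm x)
    rw [ψ.apply_symm_apply] at h1 h2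
    rw [hx, hkl, ← h2, hx' l (Ne.symm hne)] at h1
    exact one_ne_zero h1
  refine ⟨τ, Fin.eq_id_or_eq_rev_of_adjacent τ hinj fun k k' hk => ?_, huniq, hroot⟩
  by_contra! hne
  -- root vectors that are not neighbours commute, hence so do their images
  have hcomm : ⁅rootVec F (τ k), rootVec F (τ k')⁆ = 0 :=
    lie_e_e_of_ne _ _ _ _ _ _ (fun h => hne.1 (Fin.ext_iff.1 h).symm)
      (fun h => hne.2 (Fin.ext_iff.1 h).symm)
  have h1 := congrArg (fun z : UT F n => (z : Matrix (Fin n) (Fin n) F) (row k) (col k'))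
    (LieEquiv.map_lie ψ (rootVec F (τ k)) (rootVec F (τ k')))
  have hd : ∀ j i, (ψ (rootVec F j) : Matrix (Fin n) (Fin n) F) i i = 0 :=
    fun j => map_e_apply_self ψ _ _ (row_lt_col j)
  have hkk' : τ k ≠ τ k' := fun h => by
    rw [hinj h] at hk
    omega
  -- so the entry of `⁅ψ e_{τ k}, ψ e_{τ k'}⁆` two places above the diagonal is a product of two
  -- nonzero entries
  have h2 : superdiag k (ψ (rootVec F (τ k'))) = 0 := by
    by_contra h
    exact hkk' ((huniq _ _).1 h).symm
  rw [hcomm, map_zero] at h1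
  simp only [coe_lie, Matrix.sub_apply] at h1
  rw [mul_apply_of_diag_eq_zero _ _ (hd _) (hd _) k k' hk,
    mul_apply_of_diag_eq_zero _ _ (hd _) (hd _) k k' hk, h2, zero_mul, sub_zero] at h1
  exact mul_ne_zero (hτ k) (hτ k') h1.symm

end UT

/-! ### Elementary and type 2 gradings -/

namespace UT

section Degree

variable {G : Type*} [Group G] {n : ℕ}

/-- The partial product `g_1 ⋯ g_k` of the sequence `η`, with missing entries read as `1`. -/
def partialProd (η : Fin (n - 1) → G) : ℕ → G
  | 0 => 1
  | k + 1 => partialProd η k * if h : k < n - 1 then η ⟨k, h⟩ else 1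

/-- The degree `g_i ⋯ g_{j-1}` of the matrix unit `e_{ij}`, written as a quotient of partial
products so that it is multiplicative along paths `i`, `j`, `k`. -/
def unitDegree (η : Fin (n - 1) → G) (i j : Fin n) : G :=
  (partialProd η i)⁻¹ * partialProd η j

theorem commute_partialProd {η : Fin (n - 1) → G} {g : G} (hg : ∀ i, Commute g (η i)) (k : ℕ) :
    Commute g (partialProd η k) := by
  induction k with
  | zero => exact Commute.one_right g
  | succ k ih =>
    refine ih.mul_right ?_
    split_ifs
    · exact hg _
    · exact Commute.one_right g

theorem commute_partialProd_partialProd {η : Fin (n - 1) → G}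
    (hη : ∀ i j, Commute (η i) (η j)) (k l : ℕ) :
    Commute (partialProd η k) (partialProd η l) :=
  commute_partialProd (fun i => (commute_partialProd (hη i) k).symm) l

theorem commute_unitDegree {η : Fin (n - 1) → G} {g : G} (hg : ∀ i, Commute g (η i))
    (i j : Fin n) : Commute g (unitDegree η i j) :=
  (commute_partialProd hg i).inv_right.mul_right (commute_partialProd hg j)

theorem commute_unitDegree_unitDegree {η : Fin (n - 1) → G}
    (hη : ∀ i j, Commute (η i) (η j)) (i j k l : Fin n) :
    Commute (unitDegree η i j) (unitDegree η k l) :=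
  commute_unitDegree (fun m => (commute_unitDegree (hη m) i j).symm) k l

theorem unitDegree_mul (η : Fin (n - 1) → G) (i j k : Fin n) :
    unitDegree η i j * unitDegree η j k = unitDegree η i k := by
  simp only [unitDegree]
  group

theorem unitDegree_self (η : Fin (n - 1) → G) (i : Fin n) : unitDegree η i i = 1 :=
  inv_mul_cancel _

theorem unitDegree_row_col (η : Fin (n - 1) → G) (k : Fin (n - 1)) :
    unitDegree η (row k) (col k) = η k := by
  have : partialProd η (col k : ℕ) = partialProd η (row k : ℕ) * η k := by
    change partialProd η (k : ℕ) * (if h : (k : ℕ) < n - 1 then η ⟨k, h⟩ else 1) = _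
    rw [dif_pos k.2]
    rfl
  rw [unitDegree, this, inv_mul_cancel_left]

theorem partialProd_mul_rev {η : Fin (n - 1) → G} (hη : ∀ i j, Commute (η i) (η j))
    (hrev : η = seqRev η) (k l : ℕ) (hkl : k + l + 1 = n) :
    partialProd η k * partialProd η l = partialProd η (n - 1) := by
  induction k generalizing l with
  | zero =>
    rw [show n - 1 = l by omega]
    exact one_mul _
  | succ k ih =>
    rw [← ih (l + 1) (by omega)]
    have h1 : k < n - 1 := by omega
    have h2 : l < n - 1 := by omega
    have h3 : η ⟨l, h2⟩ = η ⟨k, h1⟩ := by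
      conv_rhs => rw [hrev]
      exact congrArg η (Fin.ext (by simp [Fin.val_rev]; omega))
    simp only [partialProd, dif_pos h1, dif_pos h2, h3]
    rw [mul_assoc, (commute_partialProd (hη ⟨k, h1⟩) l).eq]

theorem unitDegree_rev {η : Fin (n - 1) → G} (hη : ∀ i j, Commute (η i) (η j))
    (hrev : η = seqRev η) (i j : Fin n) : unitDegree η j.rev i.rev = unitDegree η i j := by
  have h1 := partialProd_mul_rev hη hrev i i.rev (by simp [Fin.val_rev]; omega)
  have h2 := partialProd_mul_rev hη hrev j j.rev (by simp [Fin.val_rev]; omega)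
  have h3 : ∀ k l, Commute (partialProd η k) (partialProd η l) :=
    commute_partialProd_partialProd hη
  rw [unitDegree, unitDegree, inv_mul_eq_iff_eq_mul, ← mul_assoc,
    ← (h3 i j.rev).inv_left.eq, mul_assoc, (h3 j.rev j).eq, h2, ← h1, inv_mul_cancel_left]

end Degree

variable {F G : Type*} [Field F] [Group G] {n : ℕ}

/-- The matrices supported on the positions of degree `h` in the elementary grading by `η`. -/
def elemComponent (F : Type*) [Field F] (η : Fin (n - 1) → G) (h : G) :
    Submodule F (UT F n) where
  carrier := {x | ∀ i j, (x : Matrix (Fin n) (Fin n) F) i j ≠ 0 → unitDegree η i j = h}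
  add_mem' := by
    intro x y hx hy i j hij
    by_cases h0 : (x : Matrix (Fin n) (Fin n) F) i j = 0
    · refine hy i j fun h1 => hij ?_
      change (x : Matrix (Fin n) (Fin n) F) i j + (y : Matrix (Fin n) (Fin n) F) i j = 0
      rw [h0, h1, add_zero]
    · exact hx i j h0
  zero_mem' := fun i j h => (h rfl).elim
  smul_mem' := by
    intro c x hx i j hij
    refine hx i j fun h0 => hij ?_
    change c * (x : Matrix (Fin n) (Fin n) F) i j = 0
    rw [h0, mul_zero]

theorem e_mem_elemComponent (η : Fin (n - 1) → G) (i j : Fin n) (hij : i ≤ j) :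
    e i j hij ∈ elemComponent F η (unitDegree η i j) := by
  intro a b hab
  rw [e_apply] at hab
  split_ifs at hab with h
  · rw [h.1, h.2]
  · exact (hab rfl).elim

theorem diag_le_elemComponent (η : Fin (n - 1) → G) :
    diag F n ≤ elemComponent F η 1 := by
  intro x hx i j hij
  obtain rfl : i = j := by
    by_contra hne
    exact hij (hx hne)
  exact unitDegree_self η i

theorem lie_mem_elemComponent {η : Fin (n - 1) → G} (hη : ∀ i j, Commute (η i) (η j))
    (h k : G) (x y : UT F n) (hx : x ∈ elemComponent F η h) (hy : y ∈ elemComponent F η k) :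
    ⁅x, y⁆ ∈ elemComponent F η (h * k) := by
  intro i j hij
  rw [coe_lie, Matrix.sub_apply, Matrix.mul_apply, Matrix.mul_apply] at hij
  by_contra hne
  refine hij ?_
  rw [Finset.sum_eq_zero, Finset.sum_eq_zero, sub_zero]
  · intro l _
    by_contra h0
    have h1 := hx l j (right_ne_zero_of_mul h0)
    have h2 := hy i l (left_ne_zero_of_mul h0)
    refine hne ?_
    rw [← h1, ← h2, (commute_unitDegree_unitDegree hη _ _ _ _).eq, unitDegree_mul]
  · intro l _
    by_contra h0
    have h1 := hx i l (left_ne_zero_of_mul h0)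
    have h2 := hy l j (right_ne_zero_of_mul h0)
    exact hne (by rw [← h1, ← h2, unitDegree_mul])

/-- Independence of the components `elemComponent F η h`, for a family of degrees `f h`. -/
theorem eq_zero_of_sum_elemComponent_eq_zero (η : Fin (n - 1) → G) {f : G → G}
    (hf : Function.Injective f) (S : Finset G) (v : G → UT F n)
    (hv : ∀ h ∈ S, v h ∈ elemComponent F η (f h)) (h0 : ∑ h ∈ S, v h = 0) :
    ∀ h ∈ S, v h = 0 := by
  intro h hh
  refine ext_apply fun i j _ => ?_
  change _ = (0 : F)
  by_contra hne
  refine hne ?_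
  have hd := hv h hh i j hne
  have h1 := sum_apply S v i j
  rw [h0, Finset.sum_eq_single_of_mem h hh] at h1
  · exact h1.symm
  · intro k hk hkh
    by_contra hk0
    exact hkh (hf ((hv k hk i j hk0).symm.trans hd))

/-- The elementary grading by `η`, with all diagonal matrices in degree `1`. -/
def elemGrading (F : Type*) [Field F] (η : Fin (n - 1) → G) (hη : ∀ i j, Commute (η i) (η j)) :
    LieGrading F G (UT F n) where
  component := elemComponent F η
  isInternal := by
    refine LieGrading.isInternal_of_sum_eq_zero _
      (eq_zero_of_sum_elemComponent_eq_zero η Function.injective_id) fun x => ?_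
    rw [eq_top_of_e_mem (⨆ h, elemComponent F η h) fun i j hij =>
      Submodule.mem_iSup_of_mem _ (e_mem_elemComponent η i j hij)]
    trivial
  lie_mem hx hy := lie_mem_elemComponent hη _ _ _ _ hx hy

theorem flip_flip (x : UT F n) : flip F n (flip F n x) = x := by
  ext i j
  simp [flip_apply]

theorem flip_mem_elemComponent {η : Fin (n - 1) → G} (hη : ∀ i j, Commute (η i) (η j))
    (hrev : η = seqRev η) {h : G} {x : UT F n} (hx : x ∈ elemComponent F η h) :
    flip F n x ∈ elemComponent F η h := by
  intro i j hij
  rw [← unitDegree_rev hη hrev]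
  exact hx _ _ (by simpa [flip_apply] using hij)

theorem Xplus_eq (i j : Fin n) (hij : i ≤ j) :
    Xplus (F := F) i j hij = e i j hij - flip F n (e i j hij) := by
  rw [flip_e, sub_neg_eq_add, Xplus]

theorem Xminus_eq (i j : Fin n) (hij : i ≤ j) :
    Xminus (F := F) i j hij = e i j hij + flip F n (e i j hij) := by
  rw [flip_e, ← sub_eq_add_neg, Xminus]

theorem flip_Xplus (i j : Fin n) (hij : i ≤ j) :
    flip F n (Xplus i j hij) = -Xplus i j hij := by
  rw [Xplus_eq, map_sub, flip_flip, neg_sub]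

theorem flip_Xminus (i j : Fin n) (hij : i ≤ j) :
    flip F n (Xminus i j hij) = Xminus i j hij := by
  rw [Xminus_eq, map_add, flip_flip, add_comm]

theorem flip_one : flip F n (one F n) = -one F n := by
  ext i j
  change -(one F n : Matrix (Fin n) (Fin n) F) j.rev i.rev =
    -(one F n : Matrix (Fin n) (Fin n) F) i j
  simp only [one_apply, Fin.rev_inj, eq_comm]

/-- The homogeneous component of degree `h` of the type 2 grading: the elementary grading refined
by the eigenspaces of `flip`, where the eigenvalue `-1` contributes the degree `g`. -/
def typeTwoComponent (F : Type*) [Field F] (g : G) (η : Fin (n - 1) → G) (h : G) :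
    Submodule F (UT F n) where
  carrier := {x | x + flip F n x ∈ elemComponent F η h ∧
    x - flip F n x ∈ elemComponent F η (g * h)}
  add_mem' := fun {x y} hx hy => by
    constructor
    · rw [map_add, add_add_add_comm]
      exact add_mem hx.1 hy.1
    · rw [map_add, add_sub_add_comm]
      exact add_mem hx.2 hy.2
  zero_mem' := by simp
  smul_mem' := fun c x hx => by
    constructor
    · rw [map_smul, ← smul_add]
      exact Submodule.smul_mem _ _ hx.1
    · rw [map_smul, ← smul_sub]
      exact Submodule.smul_mem _ _ hx.2

section TypeTwo

variable {g : G} {η : Fin (n - 1) → G}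

theorem Xminus_mem_typeTwoComponent (hη : ∀ i j, Commute (η i) (η j)) (hrev : η = seqRev η)
    (i j : Fin n) (hij : i ≤ j) :
    Xminus i j hij ∈ typeTwoComponent F g η (unitDegree η i j) := by
  have : Xminus i j hij ∈ elemComponent F η (unitDegree η i j) := by
    rw [Xminus_eq]
    exact add_mem (e_mem_elemComponent η i j hij)
      (flip_mem_elemComponent hη hrev (e_mem_elemComponent η i j hij))
  refine ⟨?_, ?_⟩
  · rw [flip_Xminus]
    exact add_mem this this
  · rw [flip_Xminus, sub_self]
    exact zero_mem _

theorem Xplus_mem_typeTwoComponent (hg : g * g = 1) (hη : ∀ i j, Commute (η i) (η j))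
    (hrev : η = seqRev η) (i j : Fin n) (hij : i ≤ j) :
    Xplus i j hij ∈ typeTwoComponent F g η (g * unitDegree η i j) := by
  have : Xplus i j hij ∈ elemComponent F η (unitDegree η i j) := by
    rw [Xplus_eq]
    exact sub_mem (e_mem_elemComponent η i j hij)
      (flip_mem_elemComponent hη hrev (e_mem_elemComponent η i j hij))
  refine ⟨?_, ?_⟩
  · rw [flip_Xplus, add_neg_cancel]
    exact zero_mem _
  · rw [flip_Xplus, sub_neg_eq_add, ← mul_assoc, hg, one_mul]
    exact add_mem this this

theorem one_mem_typeTwoComponent (hg : g * g = 1) : one F n ∈ typeTwoComponent F g η g := by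
  refine ⟨?_, ?_⟩
  · rw [flip_one, add_neg_cancel]
    exact zero_mem _
  · rw [flip_one, sub_neg_eq_add, hg]
    exact diag_le_elemComponent η (add_mem one_mem_diag one_mem_diag)

theorem commute_of_mem_elemComponent (hgη : ∀ i, Commute g (η i)) {h : G} {x : UT F n}
    (hx : x ∈ elemComponent F η h) (hx0 : x ≠ 0) : Commute g h := by
  obtain ⟨i, j, hij⟩ : ∃ i j, (x : Matrix (Fin n) (Fin n) F) i j ≠ 0 := by
    by_contra! H
    exact hx0 (ext_apply fun i j _ => H i j)
  rw [← hx i j hij]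
  exact commute_unitDegree hgη i j

theorem lie_mem_typeTwoComponent (h2 : (2 : F) ≠ 0) (hg : g * g = 1)
    (hη : ∀ i j, Commute (η i) (η j)) (hgη : ∀ i, Commute g (η i)) (h k : G) (x y : UT F n)
    (hx : x ∈ typeTwoComponent F g η h) (hy : y ∈ typeTwoComponent F g η k) :
    ⁅x, y⁆ ∈ typeTwoComponent F g η (h * k) := by
  have half : ∀ (a : G) (z : UT F n), (2 : F) • z ∈ elemComponent F η a →
      z ∈ elemComponent F η a := fun a z hz => (Submodule.smul_mem_iff _ h2).1 hz
  obtain ⟨hx1, hx2⟩ := hx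
  obtain ⟨hy1, hy2⟩ := hy
  constructor
  · have key : (2 : F) • (⁅x, y⁆ + flip F n ⁅x, y⁆) =
        ⁅x + flip F n x, y + flip F n y⁆ + ⁅x - flip F n x, y - flip F n y⁆ := by
      rw [LieEquiv.map_lie, two_smul]
      simp only [add_lie, lie_add, sub_lie, lie_sub]
      abel
    refine half _ _ ?_
    rw [key]
    refine add_mem (lie_mem_elemComponent hη _ _ _ _ hx1 hy1) ?_
    rcases eq_or_ne (x - flip F n x) 0 with h0 | h0
    · rw [h0, zero_lie]
      exact zero_mem _
    · have hc := commute_of_mem_elemComponent hgη hx2 h0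
      have := lie_mem_elemComponent hη _ _ _ _ hx2 hy2
      rwa [← mul_assoc, ← hc.eq, ← mul_assoc, hg, one_mul] at this
  · have key : (2 : F) • (⁅x, y⁆ - flip F n ⁅x, y⁆) =
        ⁅x + flip F n x, y - flip F n y⁆ + ⁅x - flip F n x, y + flip F n y⁆ := by
      rw [LieEquiv.map_lie, two_smul]
      simp only [add_lie, lie_add, sub_lie, lie_sub]
      abel
    refine half _ _ ?_
    rw [key]
    refine add_mem ?_ ?_
    · rcases eq_or_ne (x + flip F n x) 0 with h0 | h0
      · rw [h0, zero_lie]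
        exact zero_mem _
      · have hc := commute_of_mem_elemComponent hgη hx1 h0
        have := lie_mem_elemComponent hη _ _ _ _ hx1 hy2
        rwa [← mul_assoc, ← hc.eq, mul_assoc] at this
    · have := lie_mem_elemComponent hη _ _ _ _ hx2 hy1
      rwa [mul_assoc] at this

theorem e_mem_of_X_mem (h2 : (2 : F) ≠ 0) (Q : Submodule F (UT F n)) (i j : Fin n) (hij : i ≤ j)
    (hp : Xplus i j hij ∈ Q) (hm : Xminus i j hij ∈ Q) : e i j hij ∈ Q := by
  refine (Submodule.smul_mem_iff _ h2).1 ?_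
  have : (2 : F) • e (F := F) i j hij = Xplus i j hij + Xminus i j hij := by
    rw [Xplus_eq, Xminus_eq, two_smul]
    abel
  rw [this]
  exact add_mem hp hm

/-- The type 2 grading with parameters `g`, `η`. -/
def typeTwoGrading (h2 : (2 : F) ≠ 0) (hg : g * g = 1) (hrev : η = seqRev η)
    (hη : ∀ i j, Commute (η i) (η j)) (hgη : ∀ i, Commute g (η i)) :
    LieGrading F G (UT F n) where
  component := typeTwoComponent F g η
  isInternal := by
    refine LieGrading.isInternal_of_sum_eq_zero _ (fun S v hv h0 h hh => ?_) fun x => ?_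
    · have hs : ∑ h ∈ S, flip F n (v h) = 0 := by
        rw [← map_sum, h0, map_zero]
      have hp := eq_zero_of_sum_elemComponent_eq_zero η Function.injective_id S
        (fun h => v h + flip F n (v h)) (fun h hh => (hv h hh).1)
        (by rw [Finset.sum_add_distrib, h0, hs, add_zero]) h hh
      have hm := eq_zero_of_sum_elemComponent_eq_zero η (mul_right_injective g) S
        (fun h => v h - flip F n (v h)) (fun h hh => (hv h hh).2)
        (by rw [Finset.sum_sub_distrib, h0, hs, sub_zero]) h hh
      have h3 : (2 : F) • v h = (v h + flip F n (v h)) + (v h - flip F n (v h)) := by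
        rw [two_smul]
        abel
      rw [hp, hm, add_zero] at h3
      exact (smul_eq_zero.1 h3).resolve_left h2
    · rw [eq_top_of_e_mem (⨆ h, typeTwoComponent F g η h) fun i j hij =>
        e_mem_of_X_mem h2 _ i j hij
          (Submodule.mem_iSup_of_mem _ (Xplus_mem_typeTwoComponent hg hη hrev i j hij))
          (Submodule.mem_iSup_of_mem _ (Xminus_mem_typeTwoComponent hη hrev i j hij))]
      trivial
  lie_mem hx hy := lie_mem_typeTwoComponent h2 hg hη hgη _ _ _ _ hx hy

theorem isTypeTwo_typeTwoGrading (h2 : (2 : F) ≠ 0) (hg : g * g = 1) (hrev : η = seqRev η)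
    (hη : ∀ i j, Commute (η i) (η j)) (hgη : ∀ i, Commute g (η i)) :
    IsTypeTwo (typeTwoGrading h2 hg hrev hη hgη) g η := by
  refine ⟨fun i j hij => ⟨⟨_, Xplus_mem_typeTwoComponent hg hη hrev i j hij⟩,
    ⟨_, Xminus_mem_typeTwoComponent hη hrev i j hij⟩⟩, fun i => ⟨?_, ?_⟩, fun k => ⟨?_, ?_⟩⟩
  · rw [← unitDegree_self η i]
    exact Xminus_mem_typeTwoComponent hη hrev i i le_rfl
  · have := Xplus_mem_typeTwoComponent (F := F) hg hη hrev i i le_rfl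
    rwa [unitDegree_self, mul_one] at this
  · rw [← unitDegree_row_col η k]
    exact Xminus_mem_typeTwoComponent hη hrev _ _ _
  · rw [← unitDegree_row_col η k]
    exact Xplus_mem_typeTwoComponent hg hη hrev _ _ _

end TypeTwo

theorem isIdentityComplement_inf_ker {S : Submodule F (UT F n)} (hS : one F n ∈ S)
    (l : UT F n →ₗ[F] F) (hl : l (one F n) = 1) :
    IsIdentityComplement S (S ⊓ LinearMap.ker l) := by
  constructor
  · rw [Submodule.eq_bot_iff]
    rintro x ⟨hx, -, hx'⟩
    obtain ⟨c, rfl⟩ := Submodule.mem_span_singleton.1 hx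
    have h0 : l (c • one F n) = 0 := hx'
    rw [map_smul, hl, smul_eq_mul, mul_one] at h0
    rw [h0, zero_smul]
  · apply le_antisymm
    · exact sup_le ((Submodule.span_singleton_le_iff_mem _ _).2 hS) inf_le_left
    · intro x hx
      rw [← add_sub_cancel (l x • one F n) x]
      refine add_mem (Submodule.mem_sup_left
        (Submodule.smul_mem _ _ (Submodule.mem_span_singleton_self _)))
        (Submodule.mem_sup_right ⟨sub_mem hx (Submodule.smul_mem _ _ hS), ?_⟩)
      simp [hl]

/-- The functional reading off the diagonal entry at `i`. -/
def diagEntry (F : Type*) [Field F] (i : Fin n) : UT F n →ₗ[F] F where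
  toFun x := (x : Matrix (Fin n) (Fin n) F) i i
  map_add' _ _ := rfl
  map_smul' _ _ := rfl

theorem diagEntry_apply (i : Fin n) (x : UT F n) :
    diagEntry F i x = (x : Matrix (Fin n) (Fin n) F) i i := rfl

theorem exists_isPracticalElementary (hn : 0 < n) (t : G) (η : Fin (n - 1) → G)
    (hη : ∀ i j, Commute (η i) (η j)) :
    ∃ Γ : LieGrading F G (UT F n), IsPracticalElementary Γ t η := by
  let l := diagEntry F (⟨0, hn⟩ : Fin n)
  have hl1 : l (one F n) = 1 := by simp [l, diagEntry_apply, one_apply]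
  have hone : one F n ∈ (elemGrading F η hη).component 1 := diag_le_elemComponent η one_mem_diag
  have hls : ∀ h ≠ 1, ∀ x ∈ (elemGrading F η hη).component h, l x = 0 := by
    intro h hh x hx
    by_contra h0
    exact hh ((hx _ _ h0).symm.trans (unitDegree_self η _))
  have hroot : ∀ k : Fin (n - 1), l (rootVec F k) = 0 := fun k =>
    map_e_apply_self LieEquiv.refl _ _ (row_lt_col k) _
  refine ⟨(elemGrading F η hη).regrade (one F n) l 1 t one_mem_center hone hl1
    (fun x y => lie_apply_self x y _) hls, diag F n ⊓ LinearMap.ker l,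
    isIdentityComplement_inf_ker one_mem_diag l hl1, fun k => ⟨?_, fun _ => hroot k⟩, ?_, ?_⟩
  · change rootVec F k - l (rootVec F k) • _ ∈ elemComponent F η (η k)
    rw [hroot, zero_smul, sub_zero]
    have := e_mem_elemComponent (F := F) η (row k) (col k) (row_le_col k)
    rwa [unitDegree_row_col] at this
  · exact ⟨by simp [hl1], fun h => (h rfl).elim⟩
  · rintro x ⟨hx, hx'⟩
    have h0 : l x = 0 := hx'
    refine ⟨?_, fun _ => h0⟩
    rw [h0, zero_smul, sub_zero]
    exact diag_le_elemComponent η hx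

theorem exists_isPracticalTypeTwo (hn : 0 < n) (h2 : (2 : F) ≠ 0) (t g : G)
    (η : Fin (n - 1) → G) (hg : g * g = 1) (hrev : η = seqRev η)
    (hη : ∀ i j, Commute (η i) (η j)) (hgη : ∀ i, Commute g (η i)) :
    ∃ Γ : LieGrading F G (UT F n), IsPracticalTypeTwo Γ t g η := by
  let U := typeTwoGrading h2 hg hrev hη hgη
  let i₀ : Fin n := ⟨0, hn⟩
  -- half the sum of the two outer diagonal entries: it vanishes on all `X_{ii}^-`
  let l := (2 : F)⁻¹ • (diagEntry F i₀ + diagEntry F i₀.rev)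
  have hl1 : l (one F n) = 1 := by
    change (2 : F)⁻¹ * ((one F n : Matrix (Fin n) (Fin n) F) i₀ i₀ +
      (one F n : Matrix (Fin n) (Fin n) F) i₀.rev i₀.rev) = 1
    simp only [one_apply, if_true, one_add_one_eq_two]
    exact inv_mul_cancel₀ h2
  have hl0 : ∀ x y : UT F n, l ⁅x, y⁆ = 0 := by
    intro x y
    change (2 : F)⁻¹ * (((⁅x, y⁆ : UT F n) : Matrix (Fin n) (Fin n) F) i₀ i₀ +
      ((⁅x, y⁆ : UT F n) : Matrix (Fin n) (Fin n) F) i₀.rev i₀.rev) = 0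
    rw [lie_apply_self, lie_apply_self, add_zero, mul_zero]
  have hone : one F n ∈ U.component g := one_mem_typeTwoComponent hg
  have hls : ∀ h ≠ g, ∀ x ∈ U.component h, l x = 0 := by
    intro h hh x hx
    change (2 : F)⁻¹ * ((x : Matrix (Fin n) (Fin n) F) i₀ i₀ +
      (x : Matrix (Fin n) (Fin n) F) i₀.rev i₀.rev) = 0
    by_contra h0
    have h1 : ((x - flip F n x : UT F n) : Matrix (Fin n) (Fin n) F) i₀ i₀ ≠ 0 := by
      change (x : Matrix (Fin n) (Fin n) F) i₀ i₀ -
        -(x : Matrix (Fin n) (Fin n) F) i₀.rev i₀.rev ≠ 0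
      rw [sub_neg_eq_add]
      exact right_ne_zero_of_mul h0
    have h3 := hx.2 i₀ i₀ h1
    rw [unitDegree_self] at h3
    exact hh (mul_left_cancel (h3.symm.trans hg.symm))
  exact ⟨U.regrade (one F n) l g t one_mem_center hone hl1 hl0 hls, U,
    U.component g ⊓ LinearMap.ker l, isTypeTwo_typeTwoGrading h2 hg hrev hη hgη,
    isIdentityComplement_inf_ker hone l hl1,
    fun h hg ht => U.regrade_component_of_ne (one F n) l g t hls hg ht,
    U.regrade_component_target (one F n) l g t hone hl1 hls,
    fun h => U.regrade_component_source (one F n) l g t h⟩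

end UT

/-! ### Classification of the elementary gradings -/

namespace UT

variable {F G : Type*} [Field F] [Group G] {n : ℕ}

theorem superdiag_one (k : Fin (n - 1)) : superdiag k (one F n) = 0 := by
  rw [superdiag_apply, one_apply, if_neg (row_lt_col k).ne]

theorem simpleRoot_one (k : Fin (n - 1)) : simpleRoot k (one F n) = 0 := by
  rw [simpleRoot_apply, one_apply, one_apply, if_pos rfl, if_pos rfl, sub_self]

/-- Superdiagonal entries and simple roots do not see central summands. -/
theorem exists_congr_mod_center (hn : 0 < n) (P : Submodule F (UT F n)) (x : UT F n)
    (hx : x ∈ P ⊔ (LieAlgebra.center F (UT F n)).toSubmodule) :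
    ∃ y ∈ P, ∀ k, superdiag k y = superdiag k x ∧ simpleRoot k y = simpleRoot k x := by
  rw [center_eq_span hn] at hx
  obtain ⟨y, hy, z, hz, rfl⟩ := Submodule.mem_sup.1 hx
  obtain ⟨c, rfl⟩ := Submodule.mem_span_singleton.1 hz
  exact ⟨y, hy, fun k => by simp [superdiag_one, simpleRoot_one]⟩

theorem row_rev (k : Fin (n - 1)) : (row k).rev = col k.rev :=
  Fin.ext (by simp [row, col, Fin.val_rev]; omega)

theorem col_rev (k : Fin (n - 1)) : (col k).rev = row k.rev :=
  Fin.ext (by simp [row, col, Fin.val_rev]; omega)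

theorem flip_rootVec (k : Fin (n - 1)) : flip F n (rootVec F k) = -rootVec F k.rev := by
  rw [rootVec, flip_e]
  simp only [row_rev, col_rev]
  rfl

theorem flip_mem_diag {x : UT F n} (hx : x ∈ diag F n) : flip F n x ∈ diag F n := by
  intro i j hij
  change -(x : Matrix (Fin n) (Fin n) F) j.rev i.rev = 0
  have : (x : Matrix (Fin n) (Fin n) F) j.rev i.rev = 0 :=
    hx fun h => hij (Fin.rev_injective h).symm
  rw [this, neg_zero]

section Elementary

variable {t t' : G} {η η' : Fin (n - 1) → G} {Γ Γ' : LieGrading F G (UT F n)}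

/-- The components of a practical elementary grading are controlled by its generators. -/
theorem IsPracticalElementary.component_le (H : IsPracticalElementary Γ t η)
    (P : G → Submodule F (UT F n)) (hP : ∀ h k x y, x ∈ P h → y ∈ P k → ⁅x, y⁆ ∈ P (h * k))
    (hone : one F n ∈ P t) (hdiag : diag F n ≤ P 1) (hroot : ∀ k, rootVec F k ∈ P (η k)) (h : G) :
    Γ.component h ≤ P h := by
  obtain ⟨V, hV, hr, h1, hV1⟩ := H
  refine Γ.component_le_of_generates P hP (fun Q hQ hmem => ?_) h
  have hVd : V ≤ diag F n := by
    rw [← hV.2]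
    exact le_sup_right
  have hd : diag F n ≤ Q := by
    rw [← hV.2]
    refine sup_le ((Submodule.span_singleton_le_iff_mem _ _).2 (hmem t _ h1 hone)) fun x hx => ?_
    exact hmem 1 x (hV1 hx) (hdiag (hVd hx))
  exact eq_top_of_generators_mem Q hQ (fun i => hd (e_mem_diag i))
    fun k => hmem _ _ (hr k) (hroot k)

theorem IsPracticalElementary.practicallyGradedIso_iff (hn : 0 < n)
    (hη' : ∀ i j, Commute (η' i) (η' j)) (H : IsPracticalElementary Γ t η)
    (H' : IsPracticalElementary Γ' t' η') :
    Γ.PracticallyGradedIso Γ' ↔ SeqEquiv η η' := by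
  rw [LieGrading.practicallyGradedIso_iff]
  constructor
  · rintro ⟨ψ, hψ⟩
    obtain ⟨τ, hτ, hsd, -⟩ := exists_diagram_symmetry ψ
    have hle : ∀ h, Γ'.component h ≤
        elemComponent F η' h ⊔ (LieAlgebra.center F (UT F n)).toSubmodule := by
      refine H'.component_le _ (fun h k x y hx hy => Submodule.mem_sup_left
        (LieGrading.lie_mem_sup_center _ (lie_mem_elemComponent hη') h k x y hx hy))
        (Submodule.mem_sup_right one_mem_center)
        ((diag_le_elemComponent η').trans le_sup_left) fun k => Submodule.mem_sup_left ?_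
      have := e_mem_elemComponent (F := F) η' (row k) (col k) (row_le_col k)
      rwa [unitDegree_row_col] at this
    have key : ∀ k, η (τ k) = η' k := by
      intro k
      obtain ⟨V, -, hr, -, -⟩ := H
      have h1 := hψ _ _ (hr (τ k))
      have h2 := (sup_le (hle _) le_sup_right) h1
      obtain ⟨y, hy, hyk⟩ := exists_congr_mod_center hn _ _ h2
      have h3 : superdiag k y ≠ 0 := by
        rw [(hyk k).1]
        exact (hsd k (τ k)).2 rfl
      have h4 := hy _ _ h3
      rw [unitDegree_row_col] at h4
      exact h4.symm
    rcases hτ with rfl | rfl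
    · exact Or.inl (funext key)
    · refine Or.inr (funext fun k => ?_)
      have := key k.rev
      rwa [Fin.rev_rev] at this
  · intro hsim
    obtain ⟨V', hV', hr', h1', hV1'⟩ := H'
    have hdiag' : diag F n ≤ Γ'.component 1 ⊔ (LieAlgebra.center F (UT F n)).toSubmodule := by
      rw [← hV'.2, center_eq_span hn]
      exact sup_le le_sup_right (hV1'.trans le_sup_left)
    have hP : ∀ ψ : UT F n ≃ₗ⁅F⁆ UT F n, ∀ h k x y,
        x ∈ (Γ'.component h ⊔ (LieAlgebra.center F (UT F n)).toSubmodule).comap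
          ψ.toLinearEquiv.toLinearMap →
        y ∈ (Γ'.component k ⊔ (LieAlgebra.center F (UT F n)).toSubmodule).comap
          ψ.toLinearEquiv.toLinearMap →
        ⁅x, y⁆ ∈ (Γ'.component (h * k) ⊔ (LieAlgebra.center F (UT F n)).toSubmodule).comap
          ψ.toLinearEquiv.toLinearMap := by
      intro ψ h k x y hx hy
      refine Submodule.mem_sup_left ?_
      change ψ ⁅x, y⁆ ∈ _
      rw [LieEquiv.map_lie]
      exact LieGrading.lie_mem_sup_center _ (fun h k x y hx hy => Γ'.lie_mem hx hy) h k _ _ hx hy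
    rcases hsim with rfl | rfl
    · refine ⟨LieEquiv.refl, H.component_le _ (hP LieEquiv.refl)
        (Submodule.mem_sup_right one_mem_center) hdiag' fun k => Submodule.mem_sup_left (hr' k)⟩
    · refine ⟨flip F n, H.component_le _ (hP (flip F n)) ?_ ?_ fun k => ?_⟩
      · exact Submodule.mem_sup_right (LieGrading.map_mem_center _ one_mem_center)
      · exact fun x hx => hdiag' (flip_mem_diag hx)
      · refine Submodule.mem_sup_left ?_
        change flip F n (rootVec F k) ∈ _
        rw [flip_rootVec]
        exact neg_mem (hr' k.rev)

theorem IsPracticalElementary.gradedIso_iff (hn : 0 < n)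
    (hη' : ∀ i j, Commute (η' i) (η' j)) (H : IsPracticalElementary Γ t η)
    (H' : IsPracticalElementary Γ' t' η') :
    Γ.GradedIso Γ' ↔ t = t' ∧ SeqEquiv η η' := by
  rw [← H.practicallyGradedIso_iff hn hη' H']
  obtain ⟨-, -, -, h1, -⟩ := H
  obtain ⟨-, -, -, h1', -⟩ := H'
  exact LieGrading.gradedIso_iff_of_center_eq_span Γ Γ' (identity_ne_zero hn)
    (identity_ne_zero hn) (center_eq_span hn) (center_eq_span hn) h1 h1'

end Elementary

/-! ### Classification of the type 2 gradings -/

section TypeTwo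

variable {t t' g g' : G} {η η' : Fin (n - 1) → G} {Γ Γ' U U' : LieGrading F G (UT F n)}

/-- The components of a type 2 grading are controlled by its generators. -/
theorem IsTypeTwo.component_le (h2 : (2 : F) ≠ 0) (H : IsTypeTwo U g η)
    (P : G → Submodule F (UT F n)) (hP : ∀ h k x y, x ∈ P h → y ∈ P k → ⁅x, y⁆ ∈ P (h * k))
    (hdm : ∀ i, Xminus i i le_rfl ∈ P 1) (hdp : ∀ i, Xplus i i le_rfl ∈ P g)
    (hrm : ∀ k, Xminus (row k) (col k) (row_le_col k) ∈ P (η k))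
    (hrp : ∀ k, Xplus (row k) (col k) (row_le_col k) ∈ P (g * η k)) (h : G) :
    U.component h ≤ P h := by
  obtain ⟨-, hd, hr⟩ := H
  refine U.component_le_of_generates P hP (fun Q hQ hmem => ?_) h
  exact eq_top_of_generators_mem Q hQ
    (fun i => e_mem_of_X_mem h2 Q i i le_rfl (hmem _ _ (hd i).2 (hdp i))
      (hmem _ _ (hd i).1 (hdm i)))
    fun k => e_mem_of_X_mem h2 Q _ _ _ (hmem _ _ (hr k).2 (hrp k)) (hmem _ _ (hr k).1 (hrm k))

theorem IsTypeTwo.component_le_typeTwoComponent (h2 : (2 : F) ≠ 0) (H : IsTypeTwo U g η)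
    (hg : g * g = 1) (hrev : η = seqRev η) (hη : ∀ i j, Commute (η i) (η j))
    (hgη : ∀ i, Commute g (η i)) (h : G) : U.component h ≤ typeTwoComponent F g η h := by
  obtain ⟨-, hd, hr⟩ := isTypeTwo_typeTwoGrading h2 hg hrev hη hgη
  exact H.component_le h2 (typeTwoComponent F g η) (lie_mem_typeTwoComponent h2 hg hη hgη)
    (fun i => (hd i).1) (fun i => (hd i).2) (fun k => (hr k).1) (fun k => (hr k).2) h

/-- Moving the identity matrix to another degree does not change the components modulo the
centre. -/
theorem IsPracticalTypeTwo.exists_isTypeTwo (hn : 0 < n) (H : IsPracticalTypeTwo Γ t g η) :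
    ∃ U : LieGrading F G (UT F n), IsTypeTwo U g η ∧
      ∀ h, Γ.component h ⊔ (LieAlgebra.center F (UT F n)).toSubmodule =
        U.component h ⊔ (LieAlgebra.center F (UT F n)).toSubmodule := by
  obtain ⟨U, V, hU, hV, hne, ht, hg⟩ := H
  refine ⟨U, hU, fun h => ?_⟩
  rw [center_eq_span hn]
  by_cases h1 : h = t
  · rw [h1, ht, sup_assoc, sup_idem]
  · by_cases h3 : h = g
    · rw [h3, hg (h3 ▸ h1), ← hV.2, sup_comm (Submodule.span F _) V, sup_assoc, sup_idem]
    · rw [hne h h3 h1]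

theorem IsPracticalTypeTwo.one_mem (H : IsPracticalTypeTwo Γ t g η) :
    one F n ∈ Γ.component t := by
  obtain ⟨_, _, _, _, _, ht, _⟩ := H
  rw [ht]
  exact Submodule.mem_sup_right (Submodule.mem_span_singleton_self _)

/-- A superdiagonal entry of a homogeneous element determines its degree up to the factor `g`. -/
theorem degree_of_superdiag_ne_zero (h2 : (2 : F) ≠ 0) {h : G} {x : UT F n}
    (hx : x ∈ typeTwoComponent F g η h) (k : Fin (n - 1)) (hk : superdiag k x ≠ 0) :
    η k = h ∨ η k = g * h := by
  by_contra! hne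
  have h3 : superdiag k (x + flip F n x) = 0 := by
    by_contra h0
    exact hne.1 ((unitDegree_row_col η k).symm.trans (hx.1 _ _ h0))
  have h4 : superdiag k (x - flip F n x) = 0 := by
    by_contra h0
    exact hne.2 ((unitDegree_row_col η k).symm.trans (hx.2 _ _ h0))
  rw [map_add] at h3
  rw [map_sub] at h4
  have h5 : 2 * superdiag k x = 0 := by linear_combination h3 + h4
  exact hk ((mul_eq_zero.1 h5).resolve_left h2)

/-- At the middle superdiagonal position, which the reflection fixes, there is no ambiguity. -/
theorem degree_of_middle_superdiag_ne_zero (h2 : (2 : F) ≠ 0) {h : G} {x : UT F n}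
    (hx : x ∈ typeTwoComponent F g η h) (k : Fin (n - 1)) (hrev : k.rev = k)
    (hk : superdiag k x ≠ 0) : η k = g * h := by
  have h1 : superdiag k (x - flip F n x) = 2 * superdiag k x := by
    rw [map_sub, superdiag_apply, superdiag_apply, flip_apply, row_rev, col_rev, hrev]
    ring
  rw [← unitDegree_row_col η k]
  refine hx.2 _ _ ?_
  change superdiag k (x - flip F n x) ≠ 0
  rw [h1]
  exact mul_ne_zero h2 hk

/-- The degree `g` is visible on the diagonal: it is the only degree besides `1` that occurs
there. -/
theorem degree_of_simpleRoot_ne_zero (h2 : (2 : F) ≠ 0) (hg : g * g = 1) {h : G} (hh : h ≠ 1)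
    {x : UT F n} (hx : x ∈ typeTwoComponent F g η h) (k : Fin (n - 1))
    (hk : simpleRoot k x ≠ 0) : h = g := by
  by_contra hne
  have hd : ∀ i, (x : Matrix (Fin n) (Fin n) F) i i = 0 := by
    intro i
    have h3 : ((x + flip F n x : UT F n) : Matrix (Fin n) (Fin n) F) i i = 0 := by
      by_contra h0
      exact hh ((hx.1 i i h0).symm.trans (unitDegree_self η i))
    have h4 : ((x - flip F n x : UT F n) : Matrix (Fin n) (Fin n) F) i i = 0 := by
      by_contra h0
      have := (hx.2 i i h0).symm.trans (unitDegree_self η i)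
      exact hne (mul_left_cancel (this.trans hg.symm))
    change (x : Matrix (Fin n) (Fin n) F) i i +
      (flip F n x : Matrix (Fin n) (Fin n) F) i i = 0 at h3
    change (x : Matrix (Fin n) (Fin n) F) i i -
      (flip F n x : Matrix (Fin n) (Fin n) F) i i = 0 at h4
    have h5 : 2 * (x : Matrix (Fin n) (Fin n) F) i i = 0 := by linear_combination h3 + h4
    exact (mul_eq_zero.1 h5).resolve_left h2
  exact hk (by rw [simpleRoot_apply, hd, hd, sub_zero])

theorem Xplus_rootVec (k : Fin (n - 1)) :
    Xplus (row k) (col k) (row_le_col k) = rootVec F k + rootVec F k.rev := by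
  rw [Xplus_eq, ← rootVec, flip_rootVec, sub_neg_eq_add]

theorem Xminus_rootVec (k : Fin (n - 1)) :
    Xminus (row k) (col k) (row_le_col k) = rootVec F k - rootVec F k.rev := by
  rw [Xminus_eq, ← rootVec, flip_rootVec, ← sub_eq_add_neg]

theorem simpleRoot_Xplus_ne_zero (hn : 2 < n) (k : Fin (n - 1))
    (hk : (k : ℕ) = 0 ∨ (k : ℕ) = n - 2) :
    simpleRoot k (Xplus (F := F) ⟨0, by omega⟩ ⟨0, by omega⟩ le_rfl) ≠ 0 := by
  rw [Xplus, map_add, simpleRoot_apply, simpleRoot_apply]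
  simp only [e_apply, row, col, Fin.ext_iff, Fin.val_rev, and_self]
  rcases hk with hk | hk
  · rw [if_pos hk.symm, if_neg (by omega), if_neg (by omega), if_neg (by omega)]
    simp
  · rw [if_neg (by omega), if_neg (by omega), if_neg (by omega), if_pos (by omega)]
    simp

/-- For palindromic sequences `SeqEquivMod` controls all entries, not only the left half. -/
theorem _root_.SeqEquivMod.apply_eq (hrev : η = seqRev η) (hrev' : η' = seqRev η')
    (H : SeqEquivMod g η η') (k : Fin (n - 1)) : η k = η' k ∨ η k = g * η' k := by
  by_cases h1 : (k : ℕ) + 1 ≤ (n - 1) / 2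
  · exact H.1 k h1
  · by_cases h3 : 2 * ((k : ℕ) + 1) = n
    · exact Or.inl (H.2 k h3)
    · have := H.1 k.rev (by rw [Fin.val_rev]; omega)
      rwa [show η k.rev = η k from (congrFun hrev k).symm,
        show η' k.rev = η' k from (congrFun hrev' k).symm] at this

/-- Square roots of `1` with prescribed quotients of neighbours. -/
theorem exists_signs (r : Fin (n - 1) → F) (hr : ∀ k, r k * r k = 1) :
    ∃ s : Fin n → F, (∀ i, s i * s i = 1) ∧ ∀ k, s (row k) * s (col k) = r k := by
  let s : ℕ → F := fun m => Nat.rec 1 (fun j a => a * if h : j < n - 1 then r ⟨j, h⟩ else 1) m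
  have hs : ∀ j, s (j + 1) = s j * if h : j < n - 1 then r ⟨j, h⟩ else 1 := fun j => rfl
  have hs2 : ∀ j, s j * s j = 1 := by
    intro j
    induction j with
    | zero => exact one_mul 1
    | succ j ih =>
      rw [hs]
      split_ifs with h
      · linear_combination (r ⟨j, h⟩ * r ⟨j, h⟩) * ih + hr ⟨j, h⟩
      · rw [mul_one, ih]
  refine ⟨fun i => s i, fun i => hs2 i, fun k => ?_⟩
  change s k * s (k + 1) = r k
  rw [hs, dif_pos k.2, ← mul_assoc, hs2, one_mul]

/-- Equivalent sequences give isomorphic type 2 gradings, by conjugation with a diagonal matrix of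
signs. -/
theorem IsTypeTwo.exists_equiv (h2 : (2 : F) ≠ 0) (hg : g * g = 1) (hrev : η = seqRev η)
    (hrev' : η' = seqRev η') (H : IsTypeTwo U g η) (H' : IsTypeTwo U' g η')
    (hsim : SeqEquivMod g η η') :
    ∃ ψ : UT F n ≃ₗ⁅F⁆ UT F n, ∀ h, ∀ x ∈ U.component h, ψ x ∈ U'.component h := by
  classical
  -- the sign changes sit on one side of the middle, where `η` and `η'` differ
  let r : Fin (n - 1) → F := fun k => if n < 2 * ((k : ℕ) + 1) ∧ η k ≠ η' k then -1 else 1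
  obtain ⟨s, hs, hsr⟩ := exists_signs r fun k => by
    simp only [r]
    split_ifs <;> ring
  have hroot : ∀ k, conjDiag s hs (rootVec F k) = r k • rootVec F k := fun k => by
    rw [rootVec, conjDiag_e, hsr]
  have hη : ∀ k, η k.rev = η k := fun k => (congrFun hrev k).symm
  have hη' : ∀ k, η' k.rev = η' k := fun k => (congrFun hrev' k).symm
  obtain ⟨-, hd', hr'⟩ := H'
  have hdiag : ∀ i, conjDiag s hs (e i i le_rfl) = e i i le_rfl := fun i => by
    rw [conjDiag_e, hs, one_smul]
  have hroots : ∀ k,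
      conjDiag s hs (Xminus (row k) (col k) (row_le_col k)) ∈ U'.component (η k) ∧
      conjDiag s hs (Xplus (row k) (col k) (row_le_col k)) ∈ U'.component (g * η k) := by
    intro k
    rw [Xminus_rootVec, Xplus_rootVec, map_sub, map_add, hroot, hroot]
    by_cases hk : η k = η' k
    · have h3 : r k = 1 := if_neg fun h => h.2 hk
      have h4 : r k.rev = 1 := if_neg fun h => h.2 (by rw [hη, hη', hk])
      rw [h3, h4, one_smul, one_smul, ← Xminus_rootVec, ← Xplus_rootVec, hk]
      exact hr' k
    · have hkg : η k = g * η' k := (SeqEquivMod.apply_eq hrev hrev' hsim k).resolve_left hk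
      have hkg' : g * η k = η' k := by rw [hkg, ← mul_assoc, hg, one_mul]
      have hkr : η k.rev ≠ η' k.rev := by rwa [hη, hη']
      have hmid : 2 * ((k : ℕ) + 1) ≠ n := fun h => hk (hsim.2 k h)
      have hval : ((k.rev : Fin (n - 1)) : ℕ) = n - 1 - (k + 1) := Fin.val_rev k
      rw [hkg', hkg]
      rcases lt_or_gt_of_ne hmid with hlt | hgt
      · have h3 : r k = 1 := if_neg fun h => by omega
        have h4 : r k.rev = -1 := if_pos ⟨by omega, hkr⟩
        rw [h3, h4, neg_smul, one_smul, one_smul, sub_neg_eq_add, ← sub_eq_add_neg,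
          ← Xminus_rootVec, ← Xplus_rootVec]
        exact ⟨(hr' k).2, (hr' k).1⟩
      · have h3 : r k = -1 := if_pos ⟨hgt, hk⟩
        have h4 : r k.rev = 1 := if_neg fun h => by omega
        rw [h3, h4, neg_smul, one_smul, one_smul, ← neg_add', neg_add_eq_sub, ← neg_sub,
          ← Xminus_rootVec, ← Xplus_rootVec]
        exact ⟨neg_mem (hr' k).2, neg_mem (hr' k).1⟩
  refine ⟨conjDiag s hs, H.component_le h2
    (fun h => (U'.component h).comap (conjDiag s hs).toLinearEquiv.toLinearMap)
    (fun h k x y hx hy => ?_) (fun i => ?_) (fun i => ?_) (fun k => (hroots k).1)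
    fun k => (hroots k).2⟩
  · change conjDiag s hs ⁅x, y⁆ ∈ U'.component (h * k)
    rw [LieEquiv.map_lie]
    exact U'.lie_mem hx hy
  · change conjDiag s hs (Xminus i i le_rfl) ∈ U'.component 1
    rw [Xminus, map_sub, hdiag, hdiag]
    exact (hd' i).1
  · change conjDiag s hs (Xplus i i le_rfl) ∈ U'.component g
    rw [Xplus, map_add, hdiag, hdiag]
    exact (hd' i).2

theorem IsTypeTwo.practicallyGradedIso_iff (hn : 2 < n) (h2 : (2 : F) ≠ 0) (hg1 : g ≠ 1)
    (hg : g * g = 1) (hg' : g' * g' = 1) (hrev : η = seqRev η) (hrev' : η' = seqRev η')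
    (hη' : ∀ i j, Commute (η' i) (η' j)) (hgη' : ∀ i, Commute g' (η' i))
    (H : IsTypeTwo U g η) (H' : IsTypeTwo U' g' η') :
    U.PracticallyGradedIso U' ↔ g = g' ∧ SeqEquivMod g η η' := by
  constructor
  · rw [LieGrading.practicallyGradedIso_iff]
    rintro ⟨ψ, hψ⟩
    obtain ⟨τ, hτ, hsd, hroot⟩ := exists_diagram_symmetry ψ
    have key : ∀ h, ∀ x ∈ U.component h, ∃ y ∈ typeTwoComponent F g' η' h,
        ∀ k, superdiag k y = superdiag k (ψ x) ∧ simpleRoot k y = simpleRoot k (ψ x) := by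
      intro h x hx
      refine exists_congr_mod_center (by omega) _ _ ?_
      exact sup_le_sup_right
        (H'.component_le_typeTwoComponent h2 hg' hrev' hη' hgη' h) _ (hψ h x hx)
    have hηrev : ∀ k, η k.rev = η k := fun k => (congrFun hrev k).symm
    have hητ : ∀ k, η (τ k) = η k := by
      rcases hτ with rfl | rfl
      · exact fun k => rfl
      · exact hηrev
    -- `X_{11}^+` has degree `g`, and since `n > 2` it is not scalar
    have hgg : g = g' := by
      obtain ⟨y, hy, hyk⟩ := key g _ (H.2.1 ⟨0, by omega⟩).2
      refine degree_of_simpleRoot_ne_zero h2 hg' hg1 hy ⟨0, by omega⟩ ?_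
      rw [(hyk _).2, hroot]
      refine simpleRoot_Xplus_ne_zero hn _ ?_
      rcases hτ with rfl | rfl
      · exact Or.inl rfl
      · right
        change n - 1 - (0 + 1) = n - 2
        omega
    refine ⟨hgg, fun k hk => ?_, fun k hk => ?_⟩
    -- away from the middle `X_{i,i+1}^-` has two nonzero entries
    · obtain ⟨y, hy, hyk⟩ := key _ _ (H.2.2 (τ k)).1
      have hne : (τ k).rev ≠ τ k := by
        intro h
        have := congrArg Fin.val h
        rcases hτ with rfl | rfl <;> simp only [id, Fin.val_rev] at this <;> omega
      have h3 : superdiag k y ≠ 0 := by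
        rw [(hyk k).1, Xminus_rootVec, map_sub, map_sub,
          not_not.1 fun h => hne ((hsd k (τ k).rev).1 h), sub_zero]
        exact (hsd k (τ k)).2 rfl
      rcases degree_of_superdiag_ne_zero h2 hy k h3 with h | h
      · exact Or.inl (by rw [h, hητ])
      · refine Or.inr ?_
        rw [h, hητ, ← hgg, ← mul_assoc, hg, one_mul]
    -- in the middle `X_{i,i+1}^-` vanishes and `X_{i,i+1}^+ = 2 e_{i,i+1}`
    · have hkr : k.rev = k := Fin.ext (by rw [Fin.val_rev]; omega)
      have hτk : τ k = k := by
        rcases hτ with rfl | rfl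
        · rfl
        · exact hkr
      obtain ⟨y, hy, hyk⟩ := key _ _ (H.2.2 k).2
      have h3 : superdiag k y ≠ 0 := by
        rw [(hyk k).1, Xplus_rootVec, hkr, ← two_smul F, map_smul, map_smul]
        exact mul_ne_zero h2 ((hsd k k).2 hτk.symm)
      have h4 := degree_of_middle_superdiag_ne_zero h2 hy k hkr h3
      rw [h4, ← hgg, ← mul_assoc, hg, one_mul]
  · rintro ⟨rfl, hsim⟩
    exact LieGrading.GradedIso.practicallyGradedIso
      (H.exists_equiv h2 hg hrev hrev' H' hsim)

theorem IsPracticalTypeTwo.practicallyGradedIso_iff (hn : 2 < n) (h2 : (2 : F) ≠ 0)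
    (hg1 : g ≠ 1) (hg : g * g = 1) (hg' : g' * g' = 1) (hrev : η = seqRev η)
    (hrev' : η' = seqRev η') (hη' : ∀ i j, Commute (η' i) (η' j))
    (hgη' : ∀ i, Commute g' (η' i)) (H : IsPracticalTypeTwo Γ t g η)
    (H' : IsPracticalTypeTwo Γ' t' g' η') :
    Γ.PracticallyGradedIso Γ' ↔ g = g' ∧ SeqEquivMod g η η' := by
  obtain ⟨U, hU, hΓ⟩ := H.exists_isTypeTwo (by omega)
  obtain ⟨U', hU', hΓ'⟩ := H'.exists_isTypeTwo (by omega)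
  rw [← hU.practicallyGradedIso_iff hn h2 hg1 hg hg' hrev hrev' hη' hgη' hU']
  exact ⟨fun h => h.congr hΓ hΓ', fun h => h.congr (fun k => (hΓ k).symm) fun k => (hΓ' k).symm⟩

theorem IsPracticalTypeTwo.gradedIso_iff (hn : 2 < n) (h2 : (2 : F) ≠ 0)
    (hg1 : g ≠ 1) (hg : g * g = 1) (hg' : g' * g' = 1) (hrev : η = seqRev η)
    (hrev' : η' = seqRev η') (hη' : ∀ i j, Commute (η' i) (η' j))
    (hgη' : ∀ i, Commute g' (η' i)) (H : IsPracticalTypeTwo Γ t g η)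
    (H' : IsPracticalTypeTwo Γ' t' g' η') :
    Γ.GradedIso Γ' ↔ g = g' ∧ t = t' ∧ SeqEquivMod g η η' := by
  have hn0 : 0 < n := by omega
  rw [and_left_comm,
    ← H.practicallyGradedIso_iff hn h2 hg1 hg hg' hrev hrev' hη' hgη' H']
  exact LieGrading.gradedIso_iff_of_center_eq_span Γ Γ' (identity_ne_zero hn0)
    (identity_ne_zero hn0) (center_eq_span hn0) (center_eq_span hn0) H.one_mem H'.one_mem

end TypeTwo

end UT

theorem theorem3 {F G : Type*} [Field F] [Group G] (n : ℕ) (hn : 2 < n) :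
    -- elementary case: the gradings exist and are classified
    ((∀ (t : G) (η : Fin (n - 1) → G), (∀ i j, Commute (η i) (η j)) →
        ∃ Γ : LieGrading F G (UT F n), UT.IsPracticalElementary Γ t η) ∧
      (∀ (t t' : G) (η η' : Fin (n - 1) → G),
        (∀ i j, Commute (η i) (η j)) → (∀ i j, Commute (η' i) (η' j)) →
        ∀ Γ Γ' : LieGrading F G (UT F n),
          UT.IsPracticalElementary Γ t η → UT.IsPracticalElementary Γ' t' η' →
          (Γ.GradedIso Γ' ↔ t = t' ∧ SeqEquiv η η') ∧
          (Γ.PracticallyGradedIso Γ' ↔ SeqEquiv η η'))) ∧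
    -- type 2 case: the gradings exist and are classified
    (ringChar F ≠ 2 →
      (∀ (t g : G) (η : Fin (n - 1) → G), g ≠ 1 → g ^ 2 = 1 → η = seqRev η →
        (∀ i j, Commute (η i) (η j)) → (∀ i, Commute g (η i)) →
        ∃ Γ : LieGrading F G (UT F n), UT.IsPracticalTypeTwo Γ t g η) ∧
      (∀ (t t' g g' : G) (η η' : Fin (n - 1) → G),
        g ≠ 1 → g ^ 2 = 1 → g' ≠ 1 → g' ^ 2 = 1 → η = seqRev η → η' = seqRev η' →
        (∀ i j, Commute (η i) (η j)) → (∀ i, Commute g (η i)) →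
        (∀ i j, Commute (η' i) (η' j)) → (∀ i, Commute g' (η' i)) →
        ∀ Γ Γ' : LieGrading F G (UT F n),
          UT.IsPracticalTypeTwo Γ t g η → UT.IsPracticalTypeTwo Γ' t' g' η' →
          (Γ.GradedIso Γ' ↔ g = g' ∧ t = t' ∧ SeqEquivMod g η η') ∧
          (Γ.PracticallyGradedIso Γ' ↔ g = g' ∧ SeqEquivMod g η η'))) := by
  refine ⟨⟨fun t η hη => UT.exists_isPracticalElementary (by omega) t η hη,
    fun t t' η η' _ hη' Γ Γ' H H' => ⟨H.gradedIso_iff (by omega) hη' H',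
      H.practicallyGradedIso_iff (by omega) hη' H'⟩⟩, fun hchar => ?_⟩
  have h2 : (2 : F) ≠ 0 := Ring.two_ne_zero hchar
  refine ⟨fun t g η _ hg hrev hη hgη => UT.exists_isPracticalTypeTwo (by omega) h2 t g η
      (by rw [← pow_two, hg]) hrev hη hgη,
    fun t t' g g' η η' hg1 hg _ hg' hrev hrev' _ _ hη' hgη' Γ Γ' H H' => ?_⟩
  rw [pow_two] at hg hg'
  exact ⟨H.gradedIso_iff hn h2 hg1 hg hg' hrev hrev' hη' hgη' H',
    H.practicallyGradedIso_iff hn h2 hg1 hg hg' hrev hrev' hη' hgη' H'⟩
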